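/- Let $\mathbb X$ be a measurable space whose diagonal is measurable in $\mathbb X\times\mathbb X$ (for example a standard Borel space), let $H$ be a probability measure on $\mathbb X$ with $H(\{x\})=0$ for every $x$, and let $\alpha,\tau>0$. Write $\mathrm{Gam}(a,r)$ for the gamma distribution with shape $a$ and rate $r$ ($\mathrm{Gam}(0,r)$ being the point mass at $0$), and $\Gamma(\alpha,\tau,H)$ for the law of the gamma process: the completely random measure $G$ on $\mathbb X$, almost surely of the form $\sum_{k\ge 1} w_k\delta_{X_k}$ with $w_k>0$ and distinct $X_k$, such that $G(A)\sim\mathrm{Gam}(\alpha H(A),\tau)$ for every measurable $A$. Let $G\sim\Gamma(\alpha,\tau,H)$. Given $G$, let $Y_\ell=(Y_{\ell1},\dots,Y_{\ell m_\ell})$, $\ell=1,\dots,L$, be independent partial rankings drawn from the nonparametric Plackett–Luce model, that is, $Y_{\ell i}$ is drawn from the normalization of $G$ restricted to $\mathbb X\setminus\{Y_{\ell1},\dots,Y_{\ell\,i-1}\}$, successively for $i=1,\dots,m_\ell$, so that $$P(Y_\ell\mid G)=\prod_{i=1}^{m_\ell}\frac{G(\{Y_{\ell i}\})}{G(\mathbb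 X\setminus\{Y_{\ell1},\dots,Y_{\ell\,i-1}\})}\qquad\text{(for lists of distinct items).}$$ Given $G$ and $(Y_\ell)_\ell$, let the auxiliary variables $Z_{\ell i}$ be mutually independent with $Z_{\ell i}\sim\mathrm{Exp}\big(G(\mathbb X\setminus\{Y_{\ell1},\dots,Y_{\ell\,i-1}\})\big)$ (rate parametrization). Let $X^*_1,\dots,X^*_K$ be the unique items among all the rankings, let $n_k$ be the number of occurrences of $X^*_k$ among them, and let $\delta_{\ell ik}=0$ if $Y_{\ell j}=X^*_k$ for some $j<i$, and $\delta_{\ell ik}=1$ otherwise. Then there is a regular conditional distribution of $G$ given $(Y_\ell,Z_\ell)_{\ell=1}^L$ that is, for almost every value of $(Y_\ell,Z_\ell)_{\ell=1}^L$, the law of $$G^*+\sum_{k=1}^K w^*_k\,\delta_{X^*_k},$$ where $G^*,w^*_1,\dots,w^*_K$ are mutually independent, $$G^*\sim\Gamma\Big(\alpha,\ \tau+\sum_{\ell,i}Z_{\ell i},\ H\Big),\qquad w^*_k\sim\mathrm{Gam}\Big(n_k,\ \tau+\sum_{\ell,i}\delta_{\ell ik}Z_{\ell i}\Big)\quad(k=1,\dots,K).$$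 -/

import Mathlib

open MeasureTheory ProbabilityTheory
open scoped ENNReal

namespace RankingModel

noncomputable section

/-! ### Gamma distributions and gamma processes -/

/-- The gamma distribution `Gam(a, r)` with shape `a ≥ 0` and inverse scale `r > 0`, where
`Gam(0, r)` is the point mass at `0`. -/
def gammaLaw (a r : ℝ) : Measure ℝ :=
  open Classical in if a = 0 then Measure.dirac 0 else gammaMeasure a r

/-- `IsGammaProcess α τ H 𝒢` says that the law `𝒢` on the space of measures on `X` is the law
`Γ(α, τ, H)` of a gamma process with concentration `α`, inverse scale `τ` and base distribution
`H`: a random measure which is almost surely of the form `∑ₖ wₖ δ_{xₖ}` with positive masses `wₖ`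
and distinct locations `xₖ`, which is completely random (its values on pairwise disjoint sets are
independent), and whose value on each measurable set `A` has distribution `Gam(α H(A), τ)`. -/
structure IsGammaProcess {X : Type*} [MeasurableSpace X] (α τ : ℝ) (H : Measure X)
    (𝒢 : Measure (Measure X)) : Prop where
  isProbabilityMeasure : IsProbabilityMeasure 𝒢
  atomic : ∀ᵐ g ∂𝒢, ∃ (w : ℕ → ℝ) (x : ℕ → X), (∀ k, 0 < w k) ∧ Function.Injective x ∧
    g = Measure.sum fun k => ENNReal.ofReal (w k) • Measure.dirac (x k)
  completelyRandom : ∀ (n : ℕ) (A : Fin n → Set X), (∀ i, MeasurableSet (A i)) →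
    Pairwise (Function.onFun Disjoint A) →
    iIndepFun (fun (i : Fin n) (g : Measure X) => g (A i)) 𝒢
  marginal : ∀ A : Set X, MeasurableSet A →
    𝒢.map (fun g => g A) = (gammaLaw (α * H.real A) τ).map ENNReal.ofReal

/-! ### Products of kernels over a finite index set -/

section KernelPi

variable {ι A : Type*} [Fintype ι] {B : ι → Type*} [MeasurableSpace A]
  [∀ i, MeasurableSpace (B i)]

/-- The kernel under which the coordinates are independent with laws `κ i a`. -/
def kernelPi (κ : ∀ i, Kernel A (B i)) [∀ i, IsFiniteKernel (κ i)] : Kernel A (∀ i, B i) where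
  toFun a := Measure.pi fun i => κ i a
  measurable' := by
    refine Measurable.measure_of_isPiSystem generateFrom_pi.symm isPiSystem_pi ?_ ?_
    · rintro s ⟨t, ht, rfl⟩
      simp only [Measure.pi_pi]
      exact Finset.measurable_fun_prod _ fun i _ =>
        Kernel.measurable_coe _ (ht i (Set.mem_univ i))
    · simp only [Measure.pi_univ]
      exact Finset.measurable_fun_prod _ fun i _ => Kernel.measurable_coe _ MeasurableSet.univ

instance (κ : ∀ i, Kernel A (B i)) [∀ i, IsFiniteKernel (κ i)] : IsFiniteKernel (kernelPi κ) := by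
  refine ⟨∏ i, (κ i).bound, ENNReal.prod_lt_top fun i _ => Kernel.bound_lt_top _, fun a => ?_⟩
  change Measure.pi (fun i => κ i a) Set.univ ≤ _
  rw [Measure.pi_univ]
  exact Finset.prod_le_prod' fun i _ => Kernel.measure_le_bound _ _ _

end KernelPi

/-! ### The nonparametric Plackett–Luce model -/

section PlackettLuce

variable {X : Type*} [MeasurableSpace X]

/-- The choice of one item: a draw from the probability measure obtained by normalizing a measure.
(Measures that are zero or infinite are sent to `0`.) -/
def normalize : Kernel (Measure X) X where
  toFun g := (g Set.univ)⁻¹ • g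
  measurable' := by
    refine Measure.measurable_of_measurable_coe _ fun s hs => ?_
    simp only [Measure.smul_apply, smul_eq_mul]
    exact (Measure.measurable_coe MeasurableSet.univ).inv.mul (Measure.measurable_coe hs)

lemma normalize_apply (g : Measure X) (s : Set X) :
    normalize g s = (g Set.univ)⁻¹ * g s := rfl

instance : IsFiniteKernel (normalize (X := X)) :=
  ⟨1, ENNReal.one_lt_top, fun g => by
    rw [normalize_apply]
    exact ENNReal.inv_mul_le_one _⟩

/-- For finite measures, the mass of a section of a measurable set depends measurably on the
measure and the section. -/
lemma measurable_mass_section {B : Type*} [MeasurableSpace B] {S : Set (B × X)}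
    (hS : MeasurableSet S) :
    Measurable fun p : Measure X × B =>
      open Classical in if p.1 Set.univ < ∞ then p.1 (Prod.mk p.2 ⁻¹' S) else 0 := by
  classical
  have h1 : Measurable fun p : Measure X × B =>
      (normalize.comap Prod.fst measurable_fst : Kernel (Measure X × B) X) p
        (Prod.mk p ⁻¹' {q : (Measure X × B) × X | (q.1.2, q.2) ∈ S}) :=
    Kernel.measurable_kernel_prodMk_left
      (hS.preimage ((measurable_snd.comp measurable_fst).prodMk measurable_snd))
  have h2 : Measurable fun p : Measure X × B => p.1 Set.univ :=
    (Measure.measurable_coe MeasurableSet.univ).comp measurable_fst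
  convert Measurable.ite (measurableSet_lt h2 (measurable_const (a := ∞))) (h2.mul h1)
    (measurable_const (a := 0)) using 1
  swap
  · infer_instance
  funext p
  by_cases hp : p.1 Set.univ < ∞
  · simp only [Pi.mul_apply, hp, if_true, Kernel.comap_apply]
    rw [normalize_apply, ← mul_assoc]
    by_cases h0 : p.1 Set.univ = 0
    · have : p.1 = 0 := Measure.measure_univ_eq_zero.1 h0
      simp [this]
    · rw [ENNReal.mul_inv_cancel h0 hp.ne, one_mul]
      rfl
  · simp [hp]

variable [MeasurableEq X]

/-- The finite measure `g` with the item `x` removed. (Infinite measures are sent to `0`.) -/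
def removeItem (p : Measure X × X) : Measure X :=
  open Classical in if p.1 Set.univ < ∞ then p.1.restrict {p.2}ᶜ else 0

lemma measurable_removeItem : Measurable (removeItem : Measure X × X → Measure X) := by
  classical
  refine Measure.measurable_of_measurable_coe _ fun s hs => ?_
  have hS : MeasurableSet {q : X × X | q.2 ∈ s ∧ q.2 ≠ q.1} :=
    (hs.preimage measurable_snd).inter
      (measurableSet_eq_fun measurable_snd measurable_fst).compl
  convert measurable_mass_section hS using 1
  funext p
  by_cases hp : p.1 Set.univ < ∞
  · simp only [removeItem, hp, if_true]
    rw [Measure.restrict_apply hs]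
    rfl
  · simp [removeItem, hp]

/-- The nonparametric Plackett–Luce model: the conditional law, given the (atomic, finite) measure
`g`, of a top-`m` list of items. The first item is drawn from the normalization of `g`; then the
atom at that item is removed from `g`, and the other `m - 1` items are drawn in the same way from
the remaining measure. Hence a list `(y₁, …, yₘ)` of distinct items has probability
`∏ᵢ g({yᵢ}) / g(X \ {y₁, …, yᵢ₋₁})`. -/
def plackettLuce : (m : ℕ) → Kernel (Measure X) (Fin m → X)
  | 0 => Kernel.const _ (Measure.dirac Fin.elim0)
  | m + 1 => (normalize ⊗ₖ ((plackettLuce m).comap removeItem measurable_removeItem)).map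
      fun p => (Fin.cons p.1 p.2 : Fin (m + 1) → X)

instance (m : ℕ) : IsFiniteKernel (plackettLuce (X := X) m) := by
  induction m with
  | zero => unfold plackettLuce; infer_instance
  | succ m ih => unfold plackettLuce; infer_instance

/-- The law of `L` partial rankings with lengths `m ℓ` that are conditionally independent given the
measure `g`, each drawn from the nonparametric Plackett–Luce model. -/
def rankingsKernel {L : ℕ} (m : Fin L → ℕ) : Kernel (Measure X) ((ℓ : Fin L) → Fin (m ℓ) → X) :=
  kernelPi fun ℓ => plackettLuce (m ℓ)

/-! ### The auxiliary inter-arrival times -/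

/-- The exponential distribution as a kernel in its rate. -/
def expKernel : Kernel ℝ ℝ where
  toFun r := expMeasure r
  measurable' := by
    refine Measure.measurable_of_measurable_coe _ fun s hs => ?_
    have h : Measurable (Function.uncurry fun r x : ℝ => gammaPDF 1 r x) := by
      unfold gammaPDF gammaPDFReal Function.uncurry
      refine ENNReal.measurable_ofReal.comp
        (Measurable.ite (measurableSet_le measurable_const measurable_snd) ?_ measurable_const)
      fun_prop
    simp only [expMeasure, gammaMeasure, withDensity_apply _ hs]
    exact h.lintegral_prod_right' (ν := volume.restrict s)

instance : IsFiniteKernel expKernel :=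
  ⟨1, ENNReal.one_lt_top, fun r => by
    change expMeasure r Set.univ ≤ 1
    rcases lt_or_ge 0 r with hr | hr
    · have := isProbabilityMeasure_expMeasure hr
      exact prob_le_one
    · have h0 : gammaPDF 1 r = 0 := by
        funext x
        simp only [gammaPDF, gammaPDFReal, Pi.zero_apply, ENNReal.ofReal_eq_zero]
        split_ifs
        · simp only [Real.rpow_one, Real.Gamma_one, div_one, sub_self, Real.rpow_zero, mul_one]
          exact mul_nonpos_of_nonpos_of_nonneg hr (Real.exp_pos _).le
        · exact le_rfl
      simp [expMeasure, gammaMeasure, h0]⟩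

/-- `g(X \ {y₁, …, yᵢ₋₁})`: the mass that the finite measure `g` gives to the items that do not
appear in the list `y` before position `i`. (It is set to `0` for infinite measures.) -/
def remainingMass {m : ℕ} (i : Fin m) (p : Measure X × (Fin m → X)) : ℝ :=
  (open Classical in
    if p.1 Set.univ < ∞ then p.1 {x | ∀ j < i, p.2 j ≠ x} else 0).toReal

lemma measurable_remainingMass {m : ℕ} (i : Fin m) :
    Measurable (remainingMass i : Measure X × (Fin m → X) → ℝ) := by
  have hS : MeasurableSet {q : (Fin m → X) × X | ∀ j < i, q.1 j ≠ q.2} := by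
    have : {q : (Fin m → X) × X | ∀ j < i, q.1 j ≠ q.2} =
        ⋂ j : Fin m, ⋂ _ : j < i, {q : (Fin m → X) × X | q.1 j = q.2}ᶜ := by
      ext q; simp
    rw [this]
    exact MeasurableSet.iInter fun j => MeasurableSet.iInter fun _ =>
      (measurableSet_eq_fun ((measurable_pi_apply j).comp measurable_fst) measurable_snd).compl
  exact (measurable_mass_section hS).ennreal_toReal

/-- The conditional law of the auxiliary variables `Z = (Z ℓ i)` given the measure `g` and the
rankings `y`: they are independent, and `Z ℓ i` is exponentially distributed with rate
`g(X \ {y ℓ 1, …, y ℓ (i - 1)})`. -/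
def arrivalKernel {L : ℕ} (m : Fin L → ℕ) :
    Kernel (Measure X × ((ℓ : Fin L) → Fin (m ℓ) → X)) ((ℓ : Fin L) → Fin (m ℓ) → ℝ) :=
  kernelPi fun ℓ => kernelPi fun i =>
    expKernel.comap
      (fun p : Measure X × ((ℓ : Fin L) → Fin (m ℓ) → X) => remainingMass i (p.1, p.2 ℓ))
      ((measurable_remainingMass i).comp
        (measurable_fst.prodMk ((measurable_pi_apply ℓ).comp measurable_snd)))

end PlackettLuce

/-! ### Statistics of the observations, and the posterior law -/

section Posterior

variable {X : Type*} {L : ℕ} {m : Fin L → ℕ}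

/-- The set of the unique items `X*₁, …, X*_K` among all rankings. -/
def uniqueItems (y : (ℓ : Fin L) → Fin (m ℓ) → X) : Finset X :=
  open Classical in Finset.univ.biUnion fun ℓ => Finset.univ.image (y ℓ)

/-- The number of occurrences of the item `x` among all rankings. -/
def occurrences (y : (ℓ : Fin L) → Fin (m ℓ) → X) (x : X) : ℕ :=
  open Classical in ∑ ℓ, ∑ i, if y ℓ i = x then 1 else 0

/-- The occurrence indicator: `0` if `x` appears in the `ℓ`-th ranking before position `i`, and
`1` otherwise. -/
def notYet (y : (ℓ : Fin L) → Fin (m ℓ) → X) (ℓ : Fin L) (i : Fin (m ℓ)) (x : X) : ℝ :=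
  open Classical in if ∃ j < i, y ℓ j = x then 0 else 1

/-- The law of `G* + ∑ₖ w*ₖ δ_{X*ₖ}`, where the `X*ₖ` are the unique items of the rankings `y`, the
random measure `G*` has law `𝒢`, the mass `w*ₖ` has law `Gam(nₖ, τ + ∑ δ_{ℓik} z_{ℓi})` with `nₖ`
the number of occurrences of `X*ₖ`, and `G*, w*₁, …, w*_K` are mutually independent. -/
def posteriorLaw [MeasurableSpace X] (τ : ℝ) (𝒢 : Measure (Measure X))
    (y : (ℓ : Fin L) → Fin (m ℓ) → X) (z : (ℓ : Fin L) → Fin (m ℓ) → ℝ) : Measure (Measure X) :=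
  (𝒢.prod (Measure.pi fun x : uniqueItems y =>
      gammaLaw (occurrences y x) (τ + ∑ ℓ, ∑ i, notYet y ℓ i x * z ℓ i))).map
    fun p : Measure X × (uniqueItems y → ℝ) =>
      p.1 + ∑ x : uniqueItems y, ENNReal.ofReal (p.2 x) • Measure.dirac (x : X)

end Posterior

end

end RankingModel

namespace RankingModel

/-! ### Finite product measures: product integrands, densities, resampling one coordinate -/

section PiMeasure

variable {ι : Type*} [Fintype ι] {E : ι → Type*} [∀ i, MeasurableSpace (E i)]

/-! Write `R ℓ i` for the remaining mass before the `i`-th choice of ranking `ℓ`. A choice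
contributes `g({y}) / R` and its waiting time contributes the density `R * exp (-R z)`, so the
denominators cancel. Given `g`, the pair `(Y, Z)` therefore has the unnormalized law `g^{⊗n}(dy) exp
(-∑ R z) dz` on lists without repetition and nonnegative times
(`lintegral_rankingsKernel_arrivalKernel`, which rests on `lintegral_plackettLuce`).

The measure `𝒢(dg) g^{⊗n}(dy)` is disintegrated the other way round by the iterated Palm formula
(`palm_fin`, `palm_pi`): it is `Q(dy)`, with `Q` an unnormalized Pólya urn, times the law of `g + ∑
v_j δ_{y_j}`, where `g` has the prior law and the `v_j` are independent exponential variables of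
rate `τ`. One step (`palm`) comes from size-biasing a gamma variable, which adds an independent
exponential. The induction closes because adding an exponential atom keeps a gamma random measure
gamma, with an atom added to its base measure (`map_addAtoms`).

After this substitution `∑ R z` is linear in `g(X)` and in the `v_j` (`sum_remainingMass_addAtoms`),
since `H` has no atoms and so `g` does not charge the observed items. The likelihood is thus an
exponential tilt of independent gamma masses, and this changes only their rates, at the cost of a
constant depending on `(y, z)` (`lintegral_jointDensity_addAtoms`). A rate change is a rescaling, so
the posterior is the prior masses multiplied by factors measurable in `(y, z)`, which makes it a
kernel. The occurrences of one item carry independent exponential masses of a common rate, and these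
add up to `Gam(n_k, ·)` (`posteriorKernel_eq_posteriorLaw`). -/

lemma lintegral_pi_prod (μ : ∀ i, Measure (E i)) [∀ i, SigmaFinite (μ i)]
    {f : ∀ i, E i → ℝ≥0∞} (hf : ∀ i, Measurable (f i)) :
    ∫⁻ x, ∏ i, f i (x i) ∂Measure.pi μ = ∏ i, ∫⁻ x, f i x ∂μ i := by
  classical
  -- Integrating out a finite set of coordinates with `lmarginal` allows an induction that peels off
  -- one coordinate at a time.
  have key : ∀ (s : Finset ι) (x : ∀ i, E i),
      lmarginal μ s (fun x => ∏ i ∈ s, f i (x i)) x = ∏ i ∈ s, ∫⁻ x, f i x ∂μ i := by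
    intro s
    induction s using Finset.induction_on with
    | empty => intro x; simp
    | insert i s hi ih =>
      intro x
      have hm : ∀ s : Finset ι, Measurable fun x : ∀ i, E i => ∏ i ∈ s, f i (x i) := fun s =>
        Finset.measurable_fun_prod _ fun i _ => (hf i).comp (measurable_pi_apply i)
      rw [lmarginal_insert _ (hm _) hi, Finset.prod_insert hi, ← lintegral_mul_const _ (hf i)]
      refine lintegral_congr fun w => ?_
      rw [← ih (Function.update x i w)]
      simp only [lmarginal]
      rw [← lintegral_const_mul]
      · refine lintegral_congr fun v => ?_
        rw [Finset.prod_insert hi]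
        congr 2
        simp [Function.updateFinset, hi]
      · exact (hm s).comp measurable_updateFinset
  -- `lmarginal` needs a base point. Without one, some factor is empty and both sides vanish.
  rcases isEmpty_or_nonempty (∀ i, E i) with h | ⟨⟨x⟩⟩
  · obtain ⟨i, hi⟩ : ∃ i, IsEmpty (E i) := by
      by_contra! hne
      exact (h.elim fun i => (hne i).some)
    rw [lintegral_of_isEmpty, Finset.prod_eq_zero (Finset.mem_univ i)]
    rw [lintegral_of_isEmpty]
  · rw [lintegral_eq_lmarginal_univ x, key]

/-- Used for the tilted masses, for the rankings given `g` and for the waiting times: each time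
independence turns one-coordinate densities into a product density. -/
lemma pi_withDensity (μ : ∀ i, Measure (E i)) [∀ i, SigmaFinite (μ i)]
    {w : ∀ i, E i → ℝ≥0∞} (hw : ∀ i, Measurable (w i))
    [∀ i, SigmaFinite ((μ i).withDensity (w i))] :
    Measure.pi (fun i => (μ i).withDensity (w i)) =
      (Measure.pi μ).withDensity fun x => ∏ i, w i (x i) := by
  refine Measure.pi_eq fun s hs => ?_
  rw [withDensity_apply _ (MeasurableSet.univ_pi hs), Measure.restrict_pi_pi,
    lintegral_pi_prod _ hw]
  exact Finset.prod_congr rfl fun i _ => (withDensity_apply _ (hs i)).symm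

/-- Redrawing coordinate `i` independently from `ν i` turns the product of the `μ` into the product
of the `ν`. With `ν = μ` this isolates one coordinate, so that one-dimensional gamma identities can
be applied there. -/
lemma lintegral_pi_update [DecidableEq ι] (μ ν : ∀ i, Measure (E i))
    [∀ i, IsProbabilityMeasure (μ i)] [∀ i, IsProbabilityMeasure (ν i)] (i : ι)
    (h : ∀ j ≠ i, ν j = μ j) {f : (∀ i, E i) → ℝ≥0∞} (hf : Measurable f) :
    ∫⁻ x, f x ∂Measure.pi ν = ∫⁻ x, ∫⁻ w, f (Function.update x i w) ∂ν i ∂Measure.pi μ := by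
  have hm : Measurable fun p : (∀ i, E i) × E i => Function.update p.1 i p.2 := by
    refine measurable_pi_lambda _ fun j => ?_
    rcases eq_or_ne j i with rfl | hj
    · simpa using measurable_snd
    · simp only [Function.update_of_ne hj]
      exact (measurable_pi_apply j).comp measurable_fst
  have : Measure.pi ν = ((Measure.pi μ).prod (ν i)).map fun p => Function.update p.1 i p.2 := by
    refine Measure.pi_eq fun s hs => ?_
    rw [Measure.map_apply hm (MeasurableSet.univ_pi hs)]
    have : (fun p : (∀ i, E i) × E i => Function.update p.1 i p.2) ⁻¹' Set.univ.pi s =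
        (Set.univ.pi (Function.update s i Set.univ)) ×ˢ s i := by
      ext p
      simp only [Set.mem_preimage, Set.mem_pi, Set.mem_univ, true_imp_iff, Set.mem_prod]
      constructor
      · refine fun h => ⟨fun j => ?_, by simpa using h i⟩
        rcases eq_or_ne j i with rfl | hj
        · simp
        · simpa [hj] using h j
      · rintro ⟨h1, h2⟩ j
        rcases eq_or_ne j i with rfl | hj
        · simpa using h2
        · simpa [hj] using h1 j
    rw [this, Measure.prod_prod, Measure.pi_pi, ← Finset.prod_erase_mul _ _ (Finset.mem_univ i),
      ← Finset.prod_erase_mul Finset.univ (fun j => ν j (s j)) (Finset.mem_univ i)]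
    simp only [Function.update_self, measure_univ, mul_one]
    congr 1
    refine Finset.prod_congr rfl fun j hj => ?_
    rw [Function.update_of_ne (Finset.ne_of_mem_erase hj), h j (Finset.ne_of_mem_erase hj)]
  conv_lhs => rw [this]
  rw [lintegral_map hf hm]
  exact lintegral_prod _ (hf.comp hm).aemeasurable

end PiMeasure

/-! ### Gamma distributions: tilting, scaling, size-biasing -/

section Gamma

lemma gammaLaw_zero (r : ℝ) : gammaLaw 0 r = Measure.dirac 0 := by simp [gammaLaw]

lemma gammaLaw_of_pos {a : ℝ} (ha : 0 < a) (r : ℝ) : gammaLaw a r = gammaMeasure a r := by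
  simp [gammaLaw, ha.ne']

lemma isProbabilityMeasure_gammaLaw {a r : ℝ} (ha : 0 ≤ a) (hr : 0 < r) :
    IsProbabilityMeasure (gammaLaw a r) := by
  rcases ha.eq_or_lt with rfl | ha
  · rw [gammaLaw_zero]; infer_instance
  · rw [gammaLaw_of_pos ha]; exact isProbabilityMeasure_gammaMeasure ha hr

@[fun_prop]
lemma measurable_gammaPDF (a r : ℝ) : Measurable (gammaPDF a r) :=
  (measurable_gammaPDFReal a r).ennreal_ofReal

lemma lintegral_gammaMeasure (a r : ℝ) {f : ℝ → ℝ≥0∞} (hf : Measurable f) :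
    ∫⁻ w, f w ∂gammaMeasure a r = ∫⁻ w, gammaPDF a r w * f w := by
  rw [gammaMeasure, lintegral_withDensity_eq_lintegral_mul _ (measurable_gammaPDF a r) hf]
  rfl

lemma ae_nonneg_gammaLaw (a r : ℝ) : ∀ᵐ w ∂gammaLaw a r, 0 ≤ w := by
  unfold gammaLaw
  split_ifs
  · rw [ae_dirac_eq]; exact (le_rfl : (0 : ℝ) ≤ 0)
  · rw [gammaMeasure, ae_withDensity_iff (measurable_gammaPDF a r)]
    refine ae_of_all _ fun x hx => ?_
    by_contra h
    exact hx (gammaPDF_of_neg (not_le.1 h))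

/-- Exponential tilting of gamma distributions. -/
lemma lintegral_exp_mul_gammaLaw {a r s : ℝ} (ha : 0 ≤ a) (hr : 0 < r) (hs : 0 ≤ s)
    {f : ℝ → ℝ≥0∞} (hf : Measurable f) :
    ∫⁻ w, ENNReal.ofReal (Real.exp (-(s * w))) * f w ∂gammaLaw a r =
      ENNReal.ofReal ((r / (r + s)) ^ a) * ∫⁻ w, f w ∂gammaLaw a (r + s) := by
  rcases ha.eq_or_lt with rfl | ha
  · simp [gammaLaw_zero, lintegral_dirac' _ hf]
  rw [gammaLaw_of_pos ha, gammaLaw_of_pos ha, lintegral_gammaMeasure _ _ hf,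
    lintegral_gammaMeasure _ _ (by fun_prop),
    ← lintegral_const_mul _ (by fun_prop)]
  refine lintegral_congr fun w => ?_
  rw [← mul_assoc, ← mul_assoc]
  congr 1
  rcases lt_or_ge w 0 with hw | hw
  · simp [gammaPDF_of_neg hw]
  rw [gammaPDF_of_nonneg hw, gammaPDF_of_nonneg hw, ← ENNReal.ofReal_mul (by positivity),
    ← ENNReal.ofReal_mul (by positivity)]
  congr 1
  rw [Real.div_rpow hr.le (by positivity), show -((r + s) * w) = -(r * w) + -(s * w) by ring,
    Real.exp_add]
  have : (r + s) ^ a ≠ 0 := by positivity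
  field_simp

/-- A change of variables. It realizes the rate change caused by tilting as a deterministic
rescaling of the variable. -/
lemma map_mul_gammaLaw {a r c : ℝ} (ha : 0 ≤ a) (hr : 0 < r) (hc : 0 < c) :
    (gammaLaw a r).map (fun w => c * w) = gammaLaw a (r / c) := by
  rcases ha.eq_or_lt with rfl | ha
  · rw [gammaLaw_zero, gammaLaw_zero, Measure.map_dirac' (by fun_prop)]; simp
  rw [gammaLaw_of_pos ha, gammaLaw_of_pos ha]
  refine Measure.ext_of_lintegral _ fun f hf => ?_
  rw [lintegral_map hf (by fun_prop), lintegral_gammaMeasure _ _ (by fun_prop),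
    lintegral_gammaMeasure _ _ hf]
  have h := Real.map_volume_mul_left hc.ne'
  have h2 : ∫⁻ w, gammaPDF a (r / c) w * f w = ENNReal.ofReal c *
      ∫⁻ w, gammaPDF a (r / c) (c * w) * f (c * w) := by
    rw [← lintegral_map (f := fun w => gammaPDF a (r / c) w * f w) (g := fun w => c * w)
      ((measurable_gammaPDF _ _).mul hf) (by fun_prop), h, lintegral_smul_measure, smul_eq_mul,
      ← mul_assoc, abs_of_pos (by positivity), ← ENNReal.ofReal_mul hc.le,
      mul_inv_cancel₀ hc.ne']
    simp
  rw [h2, ← lintegral_const_mul _ (by have := measurable_gammaPDF a (r / c); fun_prop)]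
  refine lintegral_congr fun w => ?_
  rw [← mul_assoc]
  congr 1
  rcases lt_or_ge w 0 with hw | hw
  · simp [gammaPDF_of_neg hw, gammaPDF_of_neg (mul_neg_of_pos_of_neg hc hw)]
  rw [gammaPDF_of_nonneg hw, gammaPDF_of_nonneg (by positivity), ← ENNReal.ofReal_mul hc.le]
  congr 1
  rw [Real.div_rpow hr.le hc.le, Real.mul_rpow hc.le hw, Real.rpow_sub_one hc.ne',
    show r / c * (c * w) = r * w by field_simp]
  have : c ^ a ≠ 0 := by positivity
  field_simp

/-- The size-biased version of a gamma variable is obtained by adding an independent exponential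
variable. -/
lemma lintegral_id_mul_gammaLaw {a r : ℝ} (ha : 0 ≤ a) (hr : 0 < r)
    {f : ℝ → ℝ≥0∞} (hf : Measurable f) :
    ∫⁻ w, ENNReal.ofReal w * f w ∂gammaLaw a r =
      ENNReal.ofReal (a / r) * ∫⁻ w, ∫⁻ v, f (w + v) ∂gammaLaw 1 r ∂gammaLaw a r := by
  rcases ha.eq_or_lt with rfl | ha
  · simp [gammaLaw_zero]
  have hp1 := measurable_gammaPDF 1 r
  have hpa := measurable_gammaPDF a r
  have hin : Measurable fun w => ∫⁻ v, f (w + v) ∂gammaMeasure 1 r := by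
    have := isProbabilityMeasure_gammaMeasure one_pos hr
    exact Measurable.lintegral_prod_right' (f := fun p : ℝ × ℝ => f (p.1 + p.2)) (by fun_prop)
  rw [gammaLaw_of_pos ha, gammaLaw_of_pos one_pos, lintegral_gammaMeasure _ _ (by fun_prop),
    lintegral_gammaMeasure _ _ hin]
  have h1 : ∀ w, gammaPDF a r w * ∫⁻ v, f (w + v) ∂gammaMeasure 1 r =
      ∫⁻ x, gammaPDF a r w * (gammaPDF 1 r (x - w) * f x) := by
    intro w
    rw [lintegral_gammaMeasure _ _ (by fun_prop), ← lintegral_const_mul _ (by fun_prop),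
      ← lintegral_add_right_eq_self
        (fun x => gammaPDF a r w * (gammaPDF 1 r (x - w) * f x)) w]
    simp [add_comm]
  simp_rw [h1]
  rw [lintegral_lintegral_swap (by fun_prop), ← lintegral_const_mul _ (by
    exact Measurable.lintegral_prod_right'
      (f := fun p : ℝ × ℝ => gammaPDF a r p.2 * (gammaPDF 1 r (p.1 - p.2) * f p.1)) (by fun_prop))]
  refine lintegral_congr fun x => ?_
  simp_rw [← mul_assoc]
  rw [lintegral_mul_const _ (by fun_prop), ← mul_assoc]
  congr 1
  rcases lt_or_ge x 0 with hx | hx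
  · rw [gammaPDF_of_neg hx, zero_mul]
    symm
    rw [mul_eq_zero]; right
    rw [lintegral_eq_zero_iff (by fun_prop)]
    refine ae_of_all _ fun w => ?_
    rcases lt_or_ge w 0 with hw | hw
    · simp [gammaPDF_of_neg hw]
    · simp [gammaPDF_of_neg (show x - w < 0 by linarith)]
  -- In the convolution of the two densities the exponentials merge into `exp (-(r * x))`. What
  -- remains is `w ^ (a - 1)` on `[0, x]`, whose integral `x ^ a / a` supplies the extra factor `x`.
  have h2 : ∀ w, gammaPDF a r w * gammaPDF 1 r (x - w) = (Set.Icc 0 x).indicator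
      (fun w => ENNReal.ofReal (r ^ a / Real.Gamma a * r * Real.exp (-(r * x))) *
        ENNReal.ofReal (w ^ (a - 1))) w := by
    intro w
    by_cases hw : w ∈ Set.Icc 0 x
    · rw [Set.indicator_of_mem hw, gammaPDF_of_nonneg hw.1, gammaPDF_of_nonneg (by linarith [hw.2]),
        ← ENNReal.ofReal_mul (by have := hw.1; positivity),
        ← ENNReal.ofReal_mul (by positivity)]
      congr 1
      simp only [Real.rpow_one, Real.Gamma_one, div_one, sub_self, Real.rpow_zero, mul_one]
      rw [show -(r * x) = -(r * w) + -(r * (x - w)) by ring, Real.exp_add]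
      ring
    · rw [Set.indicator_of_notMem hw]
      rw [Set.mem_Icc, not_and_or, not_le, not_le] at hw
      rcases hw with hw | hw
      · simp [gammaPDF_of_neg hw]
      · simp [gammaPDF_of_neg (show x - w < 0 by linarith)]
  have h3 : ∫⁻ w in Set.Icc 0 x, ENNReal.ofReal (w ^ (a - 1)) = ENNReal.ofReal (x ^ a / a) := by
    rw [setLIntegral_congr Ioc_ae_eq_Icc.symm, ← ofReal_integral_eq_lintegral_ofReal]
    · rw [← intervalIntegral.integral_of_le hx, integral_rpow (by left; linarith)]
      simp [Real.zero_rpow ha.ne']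
    · have := intervalIntegral.intervalIntegrable_rpow' (a := 0) (b := x) (r := a - 1) (by linarith)
      rwa [intervalIntegrable_iff_integrableOn_Ioc_of_le hx] at this
    · rw [Filter.EventuallyLE, ae_restrict_iff' measurableSet_Ioc]
      exact ae_of_all _ fun w hw => Real.rpow_nonneg hw.1.le _
  simp_rw [h2]
  rw [lintegral_indicator measurableSet_Icc, lintegral_const_mul _ (by fun_prop), h3,
    gammaPDF_of_nonneg hx, ← ENNReal.ofReal_mul (by positivity), ← ENNReal.ofReal_mul (by positivity),
    ← ENNReal.ofReal_mul (by positivity)]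
  congr 1
  rcases hx.eq_or_lt with rfl | hx
  · simp [Real.zero_rpow ha.ne']
  rw [Real.rpow_sub_one hx.ne']
  field_simp

/-- The factor `w` raises the exponent of the density by one, and `Γ(a + 1) = a Γ(a)` leaves the
constant `a / r`. -/
lemma lintegral_id_mul_gammaLaw_succ {a r : ℝ} (ha : 0 ≤ a) (hr : 0 < r)
    {f : ℝ → ℝ≥0∞} (hf : Measurable f) :
    ∫⁻ w, ENNReal.ofReal w * f w ∂gammaLaw a r =
      ENNReal.ofReal (a / r) * ∫⁻ w, f w ∂gammaLaw (a + 1) r := by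
  rcases ha.eq_or_lt with rfl | ha
  · simp [gammaLaw_zero]
  rw [gammaLaw_of_pos ha, gammaLaw_of_pos (by positivity), lintegral_gammaMeasure _ _ hf,
    lintegral_gammaMeasure _ _ (by fun_prop),
    ← lintegral_const_mul _ (by fun_prop)]
  refine lintegral_congr fun w => ?_
  rw [← mul_assoc, ← mul_assoc]
  congr 1
  rcases lt_or_ge w 0 with hw | hw
  · simp [gammaPDF_of_neg hw]
  rw [gammaPDF_of_nonneg hw, gammaPDF_of_nonneg hw, ← ENNReal.ofReal_mul (by positivity),
    ← ENNReal.ofReal_mul (by positivity)]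
  congr 1
  rw [Real.Gamma_add_one ha.ne', Real.rpow_add_one hr.ne', add_sub_cancel_right]
  rcases hw.eq_or_lt with rfl | hw
  · simp [Real.zero_rpow ha.ne']
  have := Real.Gamma_pos_of_pos ha
  rw [Real.rpow_sub_one hw.ne']
  field_simp

/-- Both sides arise from size-biasing `Gam(a, r)`, so for `a > 0` the common factor `a / r`
cancels. At `a = 0` that factor vanishes, and the point mass is treated directly. -/
lemma lintegral_gammaLaw_add_one {a r : ℝ} (ha : 0 ≤ a) (hr : 0 < r)
    {f : ℝ → ℝ≥0∞} (hf : Measurable f) :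
    ∫⁻ w, ∫⁻ v, f (w + v) ∂gammaLaw 1 r ∂gammaLaw a r = ∫⁻ w, f w ∂gammaLaw (a + 1) r := by
  rcases ha.eq_or_lt with rfl | ha
  · have := isProbabilityMeasure_gammaLaw zero_le_one hr
    rw [gammaLaw_zero, lintegral_dirac' _ (Measurable.lintegral_prod_right'
      (f := fun p : ℝ × ℝ => f (p.1 + p.2)) (by fun_prop))]
    simp
  · have h := (lintegral_id_mul_gammaLaw ha.le hr hf).symm.trans
      (lintegral_id_mul_gammaLaw_succ ha.le hr hf)
    rwa [ENNReal.mul_right_inj (by simpa using by positivity) ENNReal.ofReal_ne_top] at h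

end Gamma

end RankingModel

namespace RankingModel

noncomputable section

universe u

/-! ### Laws of random measures are determined by finite partitions -/

section Partitions

variable {X : Type u} [MeasurableSpace X]

/-- The masses that a measure gives to the cells of the partition defined by `q`. -/
def cellMasses {T : Type*} (q : X → T) (g : Measure X) (t : T) : ℝ≥0∞ := g (q ⁻¹' {t})

lemma measurable_cellMasses {T : Type*} {q : X → T} (hq : ∀ t, MeasurableSet (q ⁻¹' {t})) :
    Measurable (cellMasses q) :=
  measurable_pi_lambda _ fun t => Measure.measurable_coe (hq t)

/-- The law of a random measure is determined by the joint laws of its values on the cells of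
finite partitions, and it suffices to consider partitions for which a fixed set is a union of
cells. -/
lemma ext_of_cellMasses {A : Set X} (hA : MeasurableSet A) {ν₁ ν₂ : Measure (Measure X)}
    [IsFiniteMeasure ν₁]
    (h : ∀ (T : Type u) [Fintype T] (q : X → T), (∀ t, MeasurableSet (q ⁻¹' {t})) →
      (∃ U : Set T, A = q ⁻¹' U) → ν₁.map (cellMasses q) = ν₂.map (cellMasses q)) :
    ν₁ = ν₂ := by
  classical
  let M : {s : Set X // MeasurableSet s} → MeasurableSpace (Measure X) := fun s =>
    (borel ℝ≥0∞).comap fun μ => μ s.1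
  -- The π-system of events that constrain the values of the measure on finitely many sets. It
  -- generates the σ-algebra on `Measure X`, which is the supremum of those pulled back along
  -- evaluations.
  let C := piiUnionInter (fun s => {t | MeasurableSet[M s] t}) Set.univ
  have hC : ∀ B ∈ C, ν₁ B = ν₂ B := by
    rintro _ ⟨F, -, f, hf, rfl⟩
    choose! B hB hBf using hf
    -- Adding `A` to the finite family makes `A` a union of cells. The cells of `q` are the atoms of
    -- the algebra generated by the family, indexed by membership vectors.
    let F' := insert (⟨A, hA⟩ : {s : Set X // MeasurableSet s}) F
    let q : X → (F' → Bool) := fun x s => decide (x ∈ s.1.1)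
    have hq : ∀ t, MeasurableSet (q ⁻¹' {t}) := by
      intro t
      have : q ⁻¹' {t} = ⋂ s : F', {x | x ∈ s.1.1 ↔ t s = true} := by
        ext x
        simp only [q, Set.mem_preimage, Set.mem_singleton_iff, funext_iff, Set.mem_iInter]
        refine forall_congr' fun s => ?_
        cases t s <;> simp
      rw [this]
      refine MeasurableSet.iInter fun s => ?_
      cases t s
      · convert s.1.2.compl using 1
        ext x; simp
      · convert s.1.2 using 1
        ext x; simp
    have hmass : ∀ s (hs : s ∈ F') (g : Measure X),
        g s.1 = ∑ t : F' → Bool, if t ⟨s, hs⟩ = true then cellMasses q g t else 0 := by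
      intro s hs g
      rw [← Finset.sum_filter]
      simp only [cellMasses]
      rw [sum_measure_preimage_singleton _ fun t _ => hq t]
      congr 1
      ext x
      simp [q]
    have hm : Measurable (cellMasses q) := measurable_cellMasses hq
    have hset : (⋂ s ∈ F, f s) = cellMasses q ⁻¹' ⋂ s : {s // s ∈ F},
        {w | (∑ t : F' → Bool,
          if t ⟨s.1, Finset.mem_insert_of_mem s.2⟩ = true then w t else 0) ∈ B s.1} := by
      ext g
      simp only [Set.mem_iInter, Set.mem_preimage, Subtype.forall]
      refine forall_congr' fun s => forall_congr' fun hs => forall_congr' fun hs' => ?_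
      rw [← hBf _ hs', Set.mem_preimage, Set.mem_ofPred_eq, ← hmass]
    have hE : MeasurableSet (⋂ s : {s // s ∈ F},
        {w : (F' → Bool) → ℝ≥0∞ | (∑ t : F' → Bool,
          if t ⟨s.1, Finset.mem_insert_of_mem s.2⟩ = true then w t else 0) ∈ B s.1}) := by
      refine MeasurableSet.iInter fun s => ?_
      have hb : MeasurableSet (B s.1) := by
        have := hB _ s.2
        rwa [← BorelSpace.measurable_eq (α := ℝ≥0∞)] at this
      refine hb.preimage (Finset.measurable_fun_sum _ fun t _ => ?_)
      split_ifs
      · exact measurable_pi_apply t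
      · exact measurable_const
    rw [hset, ← Measure.map_apply hm hE, ← Measure.map_apply hm hE, h _ q hq]
    refine ⟨{t | t ⟨⟨A, hA⟩, Finset.mem_insert_self _ _⟩ = true}, ?_⟩
    ext x
    simp [q]
  refine ext_of_generate_finite C ?_ (isPiSystem_piiUnionInter _ (fun s => ?_) _) hC
    (hC _ ⟨∅, by simp, fun _ => Set.univ, by simp, by simp⟩)
  · refine Eq.trans ?_ (generateFrom_piiUnionInter_measurableSet M Set.univ).symm
    simp only [Set.mem_univ, iSup_pos, M]
    rw [iSup_subtype]
    rfl
  · exact @MeasurableSpace.isPiSystem_measurableSet _ (M s)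

end Partitions

/-! ### Gamma laws on the extended nonnegative reals -/

section ENNRealGamma

/-- The gamma distribution as a measure on `ℝ≥0∞`. -/
def massLaw (a r : ℝ) : Measure ℝ≥0∞ := (gammaLaw a r).map ENNReal.ofReal

lemma isProbabilityMeasure_massLaw {a r : ℝ} (ha : 0 ≤ a) (hr : 0 < r) :
    IsProbabilityMeasure (massLaw a r) := by
  have := isProbabilityMeasure_gammaLaw ha hr
  exact Measure.isProbabilityMeasure_map (by fun_prop)

lemma ae_ne_top_massLaw (a r : ℝ) : ∀ᵐ w ∂massLaw a r, w ≠ ∞ := by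
  refine (ae_map_iff (by fun_prop) (measurableSet_singleton ∞).compl).2 ?_
  exact ae_of_all _ fun w => ENNReal.ofReal_ne_top

lemma massLaw_zero (r : ℝ) : massLaw 0 r = Measure.dirac 0 := by
  rw [massLaw, gammaLaw_zero, Measure.map_dirac' (by fun_prop), ENNReal.ofReal_zero]

lemma lintegral_massLaw_add_one {a r : ℝ} (ha : 0 ≤ a) (hr : 0 < r)
    {f : ℝ≥0∞ → ℝ≥0∞} (hf : Measurable f) :
    ∫⁻ w, ∫⁻ v, f (w + v) ∂massLaw 1 r ∂massLaw a r = ∫⁻ w, f w ∂massLaw (a + 1) r := by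
  have := isProbabilityMeasure_massLaw zero_le_one hr
  rw [massLaw, massLaw, massLaw, lintegral_map _ (by fun_prop), lintegral_map hf (by fun_prop),
    ← lintegral_gammaLaw_add_one ha hr (by fun_prop)]
  · refine lintegral_congr_ae ?_
    filter_upwards [ae_nonneg_gammaLaw a r] with w hw
    rw [lintegral_map (by fun_prop) (by fun_prop)]
    refine lintegral_congr_ae ?_
    filter_upwards [ae_nonneg_gammaLaw 1 r] with v hv
    rw [ENNReal.ofReal_add hw hv]
  · exact Measurable.lintegral_prod_right' (f := fun p : ℝ≥0∞ × ℝ≥0∞ => f (p.1 + p.2))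
      (ν := massLaw 1 r) (by fun_prop)

lemma lintegral_id_mul_massLaw {a r : ℝ} (ha : 0 ≤ a) (hr : 0 < r)
    {f : ℝ≥0∞ → ℝ≥0∞} (hf : Measurable f) :
    ∫⁻ w, w * f w ∂massLaw a r =
      ENNReal.ofReal (a / r) * ∫⁻ w, ∫⁻ v, f (w + v) ∂massLaw 1 r ∂massLaw a r := by
  rw [lintegral_massLaw_add_one ha hr hf, massLaw, massLaw, lintegral_map (by fun_prop)
    (by fun_prop), lintegral_map hf (by fun_prop),
    lintegral_id_mul_gammaLaw_succ ha hr (by fun_prop)]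

lemma lintegral_exp_mul_massLaw {a r s : ℝ} (ha : 0 ≤ a) (hr : 0 < r) (hs : 0 ≤ s)
    {f : ℝ≥0∞ → ℝ≥0∞} (hf : Measurable f) :
    ∫⁻ w, ENNReal.ofReal (Real.exp (-(s * w.toReal))) * f w ∂massLaw a r =
      ENNReal.ofReal ((r / (r + s)) ^ a) * ∫⁻ w, f w ∂massLaw a (r + s) := by
  rw [massLaw, massLaw, lintegral_map (by fun_prop) (by fun_prop), lintegral_map hf (by fun_prop),
    ← lintegral_exp_mul_gammaLaw ha hr hs (by fun_prop)]
  refine lintegral_congr_ae ?_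
  filter_upwards [ae_nonneg_gammaLaw a r] with w hw
  rw [ENNReal.toReal_ofReal hw]

lemma map_mul_massLaw {a r c : ℝ} (ha : 0 ≤ a) (hr : 0 < r) (hc : 0 < c) :
    (massLaw a r).map (fun w => ENNReal.ofReal c * w) = massLaw a (r / c) := by
  rw [massLaw, massLaw, ← map_mul_gammaLaw ha hr hc, Measure.map_map (by fun_prop) (by fun_prop),
    Measure.map_map (by fun_prop) (by fun_prop)]
  congr 1
  funext w
  simp [ENNReal.ofReal_mul hc.le]

lemma measurable_update_add {T : Type*} [DecidableEq T] (t : T) :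
    Measurable fun p : (T → ℝ≥0∞) × ℝ≥0∞ => Function.update p.1 t (p.1 t + p.2) := by
  refine measurable_pi_lambda _ fun j => ?_
  rcases eq_or_ne j t with rfl | hj
  · simp only [Function.update_self]; fun_prop
  · simp only [Function.update_of_ne hj]; fun_prop

/-- Adding an independent exponential variable to one of several independent gamma variables. -/
lemma lintegral_pi_massLaw_add_one {T : Type*} [Fintype T] [DecidableEq T] {a b r : T → ℝ}
    (ha : ∀ i, 0 ≤ a i) (hr : ∀ i, 0 < r i) (t : T) (hb : ∀ i, b i = a i + if i = t then 1 else 0)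
    {f : (T → ℝ≥0∞) → ℝ≥0∞} (hf : Measurable f) :
    ∫⁻ w, ∫⁻ v, f (Function.update w t (w t + v)) ∂massLaw 1 (r t)
        ∂Measure.pi (fun i => massLaw (a i) (r i)) =
      ∫⁻ w, f w ∂Measure.pi (fun i => massLaw (b i) (r i)) := by
  have hb0 : ∀ i, 0 ≤ b i := fun i => by
    have := ha i
    rw [hb]; split_ifs <;> positivity
  have h1 := fun i => isProbabilityMeasure_massLaw (ha i) (hr i)
  have h2 := fun i => isProbabilityMeasure_massLaw (hb0 i) (hr i)
  have := isProbabilityMeasure_massLaw zero_le_one (hr t)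
  have hu : Measurable fun w : T → ℝ≥0∞ =>
      ∫⁻ v, f (Function.update w t (w t + v)) ∂massLaw 1 (r t) :=
    Measurable.lintegral_prod_right' (hf.comp (measurable_update_add t))
  -- Coordinate `t` is redrawn on both sides, with shape `a t` on the left and `a t + 1` on the
  -- right, which reduces the claim to one variable.
  rw [lintegral_pi_update _ _ t (fun j _ => rfl) hu,
    lintegral_pi_update (fun i => massLaw (a i) (r i)) _ t _ hf]
  · refine lintegral_congr fun w => ?_
    simp only [Function.update_idem, Function.update_self]
    rw [hb, if_pos rfl, ← lintegral_massLaw_add_one (ha t) (hr t)]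
    exact hf.comp (measurable_update w)
  · intro j hj
    rw [hb, if_neg hj, add_zero]

end ENNRealGamma

/-! ### Gamma random measures and their Palm formula -/

section Palm

variable {X : Type u} [MeasurableSpace X]

/-- `IsGammaMeasureLaw μ r 𝒦`: under `𝒦`, the masses of the cells of each finite partition are
independent, and the mass of a set `A` is gamma distributed with shape `μ(A)` and rate `r`. -/
structure IsGammaMeasureLaw (μ : Measure X) (r : ℝ) (𝒦 : Measure (Measure X)) : Prop where
  isProbabilityMeasure : IsProbabilityMeasure 𝒦
  map_cellMasses : ∀ (T : Type u) [Fintype T] (q : X → T), (∀ t, MeasurableSet (q ⁻¹' {t})) →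
    𝒦.map (cellMasses q) = Measure.pi fun t => massLaw (μ.real (q ⁻¹' {t})) r

/-- The weaker notion forgets the series representation and allows base measures with atoms. It is
therefore stable under adding exponential atoms, as the iteration of the Palm formula requires. -/
lemma IsGammaProcess.isGammaMeasureLaw {α τ : ℝ} {H : Measure X} {𝒢 : Measure (Measure X)}
    (h : IsGammaProcess α τ H 𝒢) (hα : 0 < α) :
    IsGammaMeasureLaw (ENNReal.ofReal α • H) τ 𝒢 := by
  refine ⟨h.isProbabilityMeasure, fun T _ q hq => ?_⟩
  have := h.isProbabilityMeasure
  have hi : iIndepFun (fun t (g : Measure X) => g (q ⁻¹' {t})) 𝒢 := by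
    have := h.completelyRandom (Fintype.card T) (fun i => q ⁻¹' {(Fintype.equivFin T).symm i})
      (fun i => hq _) (fun i j hij => by
        refine Disjoint.preimage _ (by simpa using hij))
    have := this.precomp (Fintype.equivFin T).injective
    simpa using this
  have := (iIndepFun_iff_map_fun_eq_pi_map
    (fun t => (Measure.measurable_coe (hq t)).aemeasurable)).1 hi
  refine this.trans ?_
  congr 1
  funext t
  rw [h.marginal _ (hq t), massLaw, measureReal_ennreal_smul_apply, ENNReal.toReal_ofReal hα.le]

lemma cellMasses_add_smul_dirac {T : Type*} [DecidableEq T] {q : X → T}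
    (hq : ∀ t, MeasurableSet (q ⁻¹' {t})) (g : Measure X) (v : ℝ≥0∞) (x : X) :
    cellMasses q (g + v • Measure.dirac x) =
      Function.update (cellMasses q g) (q x) (cellMasses q g (q x) + v) := by
  funext t
  rcases eq_or_ne t (q x) with rfl | ht
  · simp [cellMasses, Measure.dirac_apply' _ (hq _)]
  · simp [cellMasses, Measure.dirac_apply' _ (hq _), ht, ht.symm]

lemma measurable_add_smul_dirac :
    Measurable fun p : Measure X × X × ℝ≥0∞ => p.1 + p.2.2 • Measure.dirac p.2.1 := by
  refine Measure.measurable_of_measurable_coe _ fun s hs => ?_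
  simp only [Measure.add_apply, Measure.smul_apply, smul_eq_mul]
  exact ((Measure.measurable_coe hs).comp measurable_fst).add
    (measurable_snd.snd.mul ((Measure.measurable_coe hs).comp
      (Measure.measurable_dirac.comp measurable_snd.fst)))

namespace IsGammaMeasureLaw

variable {μ : Measure X} {r : ℝ} {𝒦 : Measure (Measure X)}

lemma lintegral_cellMasses (h : IsGammaMeasureLaw μ r 𝒦) {T : Type u} [Fintype T] {q : X → T}
    (hq : ∀ t, MeasurableSet (q ⁻¹' {t})) {f : (T → ℝ≥0∞) → ℝ≥0∞} (hf : Measurable f) :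
    ∫⁻ g, f (cellMasses q g) ∂𝒦 =
      ∫⁻ w, f w ∂Measure.pi fun t => massLaw (μ.real (q ⁻¹' {t})) r := by
  rw [← h.map_cellMasses T q hq, lintegral_map hf (measurable_cellMasses hq)]

lemma map_apply (h : IsGammaMeasureLaw μ r 𝒦) (hr : 0 < r) {A : Set X} (hA : MeasurableSet A) :
    𝒦.map (fun g => g A) = massLaw (μ.real A) r := by
  classical
  -- The two-cell partition into `A` and its complement, lifted because cell index types must live
  -- in the universe of `X`.
  let q : X → ULift.{u} Bool := fun x => ⟨decide (x ∈ A)⟩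
  have hA' : A = q ⁻¹' {⟨true⟩} := by ext x; simp [q, ULift.ext_iff]
  have hq : ∀ t, MeasurableSet (q ⁻¹' {t}) := by
    rintro ⟨⟨⟩⟩
    · convert hA.compl using 1; ext x; simp [q, ULift.ext_iff]
    · rwa [← hA']
  have := fun t => isProbabilityMeasure_massLaw (measureReal_nonneg (μ := μ) (s := q ⁻¹' {t})) hr
  have h2 := congrArg (Measure.map fun w => w ⟨true⟩) (h.map_cellMasses _ q hq)
  rw [Measure.map_map (measurable_pi_apply _) (measurable_cellMasses hq),
    (measurePreserving_eval _ _).map_eq, ← hA'] at h2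
  rw [← h2]
  conv_lhs => rw [hA']
  rfl

lemma ae_finite (h : IsGammaMeasureLaw μ r 𝒦) (hr : 0 < r) : ∀ᵐ g ∂𝒦, g Set.univ < ∞ := by
  have := ae_ne_top_massLaw (μ.real Set.univ) r
  rw [← h.map_apply hr MeasurableSet.univ] at this
  filter_upwards [ae_of_ae_map (Measure.measurable_coe MeasurableSet.univ).aemeasurable this]
    with g hg using hg.lt_top

/-- A gamma law of shape `0` is the point mass at `0`. Applied to singletons, this shows that a
prior draw does not charge a fixed item when `H` has no atoms. -/
lemma ae_apply_eq_zero (h : IsGammaMeasureLaw μ r 𝒦) (hr : 0 < r) {A : Set X}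
    (hA : MeasurableSet A) (h0 : μ A = 0) : ∀ᵐ g ∂𝒦, g A = 0 := by
  have h1 : ∀ᵐ w ∂massLaw (μ.real A) r, w = 0 := by
    rw [measureReal_def, h0, ENNReal.toReal_zero, massLaw_zero, ae_dirac_eq]
    exact rfl
  rw [← h.map_apply hr hA] at h1
  exact ae_of_ae_map (Measure.measurable_coe hA).aemeasurable h1

/-- Adding an independent exponential atom to a gamma measure adds an atom to its base measure. -/
lemma add_atom [IsFiniteMeasure μ] (h : IsGammaMeasureLaw μ r 𝒦) (hr : 0 < r) (x : X) :
    IsGammaMeasureLaw (μ + Measure.dirac x) r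
      ((𝒦.prod (massLaw 1 r)).map fun p => p.1 + p.2 • Measure.dirac x) := by
  classical
  have := h.isProbabilityMeasure
  have := isProbabilityMeasure_massLaw zero_le_one hr
  have hm : Measurable fun p : Measure X × ℝ≥0∞ => p.1 + p.2 • Measure.dirac x :=
    measurable_add_smul_dirac.comp (measurable_fst.prodMk (measurable_const.prodMk measurable_snd))
  refine ⟨Measure.isProbabilityMeasure_map hm.aemeasurable, fun T _ q hq => ?_⟩
  have hc := measurable_cellMasses hq
  refine Measure.ext_of_lintegral _ fun f hf => ?_
  have hu := measurable_update_add (q x)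
  have hu' : Measurable fun w : T → ℝ≥0∞ =>
      ∫⁻ v, f (Function.update w (q x) (w (q x) + v)) ∂massLaw 1 r :=
    Measurable.lintegral_prod_right' (hf.comp hu)
  have hreal : ∀ t, (μ + Measure.dirac x).real (q ⁻¹' {t}) =
      μ.real (q ⁻¹' {t}) + if t = q x then 1 else 0 := by
    intro t
    rw [measureReal_add_apply]
    congr 1
    rw [measureReal_def, Measure.dirac_apply' _ (hq t)]
    rcases eq_or_ne t (q x) with rfl | ht
    · simp
    · simp [ht, ht.symm]
  rw [lintegral_map hf hc, lintegral_map (by exact hf.comp hc) hm, lintegral_prod _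
    (by exact (hf.comp (hc.comp hm)).aemeasurable)]
  simp_rw [cellMasses_add_smul_dirac hq]
  rw [h.lintegral_cellMasses hq hu',
    lintegral_pi_massLaw_add_one (fun _ => measureReal_nonneg) (fun _ => hr) (q x) hreal hf]

/-- Palm formula for the cells of a partition. -/
lemma lintegral_cell_mul (h : IsGammaMeasureLaw μ r 𝒦) (hr : 0 < r) {T : Type u} [Fintype T]
    [DecidableEq T] {q : X → T} (hq : ∀ t, MeasurableSet (q ⁻¹' {t})) (t : T)
    {f : (T → ℝ≥0∞) → ℝ≥0∞} (hf : Measurable f) :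
    ∫⁻ g, g (q ⁻¹' {t}) * f (cellMasses q g) ∂𝒦 =
      ENNReal.ofReal (μ.real (q ⁻¹' {t}) / r) *
        ∫⁻ g, ∫⁻ v, f (Function.update (cellMasses q g) t (cellMasses q g t + v))
          ∂massLaw 1 r ∂𝒦 := by
  have := isProbabilityMeasure_massLaw zero_le_one hr
  have h1 := fun t => isProbabilityMeasure_massLaw
    (measureReal_nonneg (μ := μ) (s := q ⁻¹' {t})) hr
  have hu' : Measurable fun w : T → ℝ≥0∞ =>
      ∫⁻ v, f (Function.update w t (w t + v)) ∂massLaw 1 r :=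
    Measurable.lintegral_prod_right' (hf.comp (measurable_update_add t))
  have hl : Measurable fun w : T → ℝ≥0∞ => w t * f w := by fun_prop
  -- The cell masses are independent, so only coordinate `t` is size-biased; redrawing it reduces
  -- the claim to `lintegral_id_mul_massLaw`.
  rw [h.lintegral_cellMasses hq hu', lintegral_pi_update _ _ t (fun j _ => rfl) hu']
  refine (h.lintegral_cellMasses hq hl).trans ?_
  rw [lintegral_pi_update _ _ t (fun j _ => rfl) hl, ← lintegral_const_mul]
  · refine lintegral_congr fun w => ?_
    simp only [Function.update_idem, Function.update_self]
    exact lintegral_id_mul_massLaw measureReal_nonneg hr (hf.comp (measurable_update w))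
  · refine Measurable.lintegral_prod_right' (f := fun p : (T → ℝ≥0∞) × ℝ≥0∞ =>
      ∫⁻ v, f (Function.update (Function.update p.1 t p.2) t
        ((Function.update p.1 t p.2) t + v)) ∂massLaw 1 r) (hu'.comp ?_)
    refine measurable_pi_lambda _ fun j => ?_
    rcases eq_or_ne j t with rfl | hj
    · simp only [Function.update_self]; fun_prop
    · simp only [Function.update_of_ne hj]; fun_prop

/-- The Palm formula for items falling in a fixed set `A`. It can be tested on partitions having `A`
as a union of cells; then `g A` is a sum of cell masses, and each summand is handled by
`lintegral_cell_mul`. -/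
lemma withDensity_apply_eq [IsFiniteMeasure μ] (h : IsGammaMeasureLaw μ r 𝒦) (hr : 0 < r)
    {A : Set X} (hA : MeasurableSet A) :
    ENNReal.ofReal r⁻¹ • ((μ.restrict A).prod (𝒦.prod (massLaw 1 r))).map
      (fun p => p.2.1 + p.2.2 • Measure.dirac p.1) = 𝒦.withDensity fun g => g A := by
  classical
  have := h.isProbabilityMeasure
  have := isProbabilityMeasure_massLaw zero_le_one hr
  have hm : Measurable fun p : X × Measure X × ℝ≥0∞ => p.2.1 + p.2.2 • Measure.dirac p.1 :=
    measurable_add_smul_dirac.comp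
      (measurable_snd.fst.prodMk (measurable_fst.prodMk measurable_snd.snd))
  have : IsFiniteMeasure (ENNReal.ofReal r⁻¹ •
      ((μ.restrict A).prod (𝒦.prod (massLaw 1 r))).map
        (fun p => p.2.1 + p.2.2 • Measure.dirac p.1)) :=
    Measure.smul_finite _ ENNReal.ofReal_ne_top
  refine ext_of_cellMasses hA fun T _ q hq ⟨U, hU⟩ => ?_
  have hc := measurable_cellMasses hq
  let _ : MeasurableSpace T := ⊤
  have hqm : Measurable q := measurable_to_countable' hq
  refine Measure.ext_of_lintegral _ fun f hf => ?_
  have hF : Measurable fun p : X × Measure X × ℝ≥0∞ =>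
      f (cellMasses q (p.2.1 + p.2.2 • Measure.dirac p.1)) := hf.comp (hc.comp hm)
  rw [lintegral_map hf hc, lintegral_map hf hc, lintegral_smul_measure,
    lintegral_map (f := fun g => f (cellMasses q g)) (hf.comp hc) hm, lintegral_prod _ hF.aemeasurable,
    lintegral_withDensity_eq_lintegral_mul _ (Measure.measurable_coe hA) (by exact hf.comp hc)]
  let F : T → ℝ≥0∞ := fun t => ∫⁻ g, ∫⁻ v,
    f (Function.update (cellMasses q g) t (cellMasses q g t + v)) ∂massLaw 1 r ∂𝒦
  -- The location of the new atom enters only through the cell containing it, so the integral over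
  -- `x` becomes a finite sum over cells.
  have h1 : ∀ x, ∫⁻ p : Measure X × ℝ≥0∞, f (cellMasses q (p.1 + p.2 • Measure.dirac x))
      ∂𝒦.prod (massLaw 1 r) = F (q x) := by
    intro x
    rw [lintegral_prod _ (by exact (hF.comp (measurable_prodMk_left (x := x))).aemeasurable)]
    simp_rw [F, cellMasses_add_smul_dirac hq]
  simp_rw [h1]
  rw [← lintegral_map (f := F) (measurable_of_finite _) hqm, lintegral_fintype, smul_eq_mul, Finset.mul_sum]
  have h2 : ∀ g : Measure X, g A = ∑ t, if t ∈ U then g (q ⁻¹' {t}) else 0 := by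
    intro g
    rw [← Finset.sum_filter, sum_measure_preimage_singleton _ fun t _ => hq t, hU]
    congr 1
    ext x
    simp
  simp only [Pi.mul_apply, h2, Finset.sum_mul]
  rw [lintegral_finsetSum]
  · refine Finset.sum_congr rfl fun t _ => ?_
    rw [Measure.map_apply hqm (measurableSet_singleton t), Measure.restrict_apply (hq t)]
    split_ifs with ht
    · rw [h.lintegral_cell_mul hr hq t hf]
      have : q ⁻¹' {t} ∩ A = q ⁻¹' {t} := by
        rw [hU, ← Set.preimage_inter]; congr 1; simpa using ht
      rw [this, div_eq_inv_mul, ENNReal.ofReal_mul (by positivity), ofReal_measureReal]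
      ring
    · have : q ⁻¹' {t} ∩ A = ∅ := by
        rw [hU, ← Set.preimage_inter, Set.singleton_inter_eq_empty.2 ht, Set.preimage_empty]
      simp [this]
  · intro t _
    split_ifs
    · exact (Measure.measurable_coe (hq t)).mul (hf.comp hc)
    · simp

/-- Palm formula for gamma measures: an item drawn with intensity `g` is distributed as an item
drawn from the base measure, and it is an additional atom with exponential mass. -/
theorem palm [IsFiniteMeasure μ] (h : IsGammaMeasureLaw μ r 𝒦) (hr : 0 < r)
    {f : X → Measure X → ℝ≥0∞} (hf : Measurable (Function.uncurry f)) :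
    ∫⁻ g, g Set.univ * ∫⁻ x, f x g ∂normalize g ∂𝒦 =
      ENNReal.ofReal r⁻¹ * ∫⁻ x, ∫⁻ p, f x (p.1 + p.2 • Measure.dirac x)
        ∂𝒦.prod (massLaw 1 r) ∂μ := by
  have := h.isProbabilityMeasure
  have := isProbabilityMeasure_massLaw zero_le_one hr
  have hm : Measurable fun p : X × Measure X × ℝ≥0∞ => p.2.1 + p.2.2 • Measure.dirac p.1 :=
    measurable_add_smul_dirac.comp
      (measurable_snd.fst.prodMk (measurable_fst.prodMk measurable_snd.snd))
  have hu : Measurable fun g : Measure X => g Set.univ := Measure.measurable_coe MeasurableSet.univ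
  have : IsFiniteMeasure (ENNReal.ofReal r⁻¹ • (μ.prod (𝒦.prod (massLaw 1 r))).map
        (fun p => (p.2.1 + p.2.2 • Measure.dirac p.1, p.1))) :=
    Measure.smul_finite _ ENNReal.ofReal_ne_top
  -- The formula as an equality of finite measures on pairs (measure, item), which need only be
  -- compared on rectangles. On `B ×ˢ A` it is `withDensity_apply_eq` for `A`, evaluated at `B`.
  have key : ENNReal.ofReal r⁻¹ • (μ.prod (𝒦.prod (massLaw 1 r))).map
        (fun p => (p.2.1 + p.2.2 • Measure.dirac p.1, p.1)) =
      (𝒦.withDensity fun g => g Set.univ) ⊗ₘ normalize := by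
    refine Measure.ext_prod fun {B A} hB hA => ?_
    have e1 := congrArg (fun ν => ν B) (h.withDensity_apply_eq hr hA)
    simp only [Measure.smul_apply] at e1 ⊢
    rw [Measure.map_apply hm hB, withDensity_apply _ hB] at e1
    rw [Measure.map_apply (hm.prodMk measurable_fst) (hB.prod hA),
      Measure.compProd_apply_prod hB hA,
      setLIntegral_withDensity_eq_setLIntegral_mul _ hu (Kernel.measurable_coe _ hA) hB]
    have e2 : ((μ.restrict A).prod (𝒦.prod (massLaw 1 r)))
        ((fun p => p.2.1 + p.2.2 • Measure.dirac p.1) ⁻¹' B) =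
        (μ.prod (𝒦.prod (massLaw 1 r)))
          ((fun p => (p.2.1 + p.2.2 • Measure.dirac p.1, p.1)) ⁻¹' B ×ˢ A) := by
      have : (μ.restrict A).prod (𝒦.prod (massLaw 1 r)) =
          (μ.prod (𝒦.prod (massLaw 1 r))).restrict (A ×ˢ Set.univ) := by
        rw [← Measure.prod_restrict, Measure.restrict_univ]
      rw [this, Measure.restrict_apply (hm hB)]
      congr 1
      ext p
      simp
    rw [← e2, e1]
    refine lintegral_congr_ae (ae_restrict_of_ae ?_)
    -- For finite `g` the density `g Set.univ` undoes the normalization; the zero measure is a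
    -- separate case.
    filter_upwards [h.ae_finite hr] with g hg
    simp only [Pi.mul_apply, normalize_apply]
    rw [← mul_assoc]
    by_cases h0 : g Set.univ = 0
    · rw [Measure.measure_univ_eq_zero.1 h0]; simp
    · rw [ENNReal.mul_inv_cancel h0 hg.ne, one_mul]
  have hf' : Measurable fun p : Measure X × X => f p.2 p.1 := hf.comp measurable_swap
  have e := congrArg (fun ν => ∫⁻ p, f p.2 p.1 ∂ν) key
  rw [lintegral_smul_measure, lintegral_map hf' (hm.prodMk measurable_fst),
    lintegral_prod _ (by exact (hf'.comp (hm.prodMk measurable_fst)).aemeasurable),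
    Measure.lintegral_compProd hf',
    lintegral_withDensity_eq_lintegral_mul _ hu (by
      exact Measurable.lintegral_kernel_prod_right' hf')] at e
  simpa using e.symm

end IsGammaMeasureLaw

end Palm

end

end RankingModel

namespace RankingModel

noncomputable section

universe u

/-! ### Splitting off and reindexing coordinates of a power measure -/

section PiFin

variable {E : Type*} [MeasurableSpace E]

lemma measurable_finCons {n : ℕ} :
    Measurable fun p : E × (Fin n → E) => (Fin.cons p.1 p.2 : Fin (n + 1) → E) := by
  refine measurable_pi_lambda _ fun i => ?_
  refine Fin.cases ?_ (fun j => ?_) i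
  · simpa using measurable_fst
  · simp only [Fin.cons_succ]; fun_prop

lemma lintegral_pi_finCons {n : ℕ} (μ : Measure E) [SigmaFinite μ]
    {f : (Fin (n + 1) → E) → ℝ≥0∞} (hf : Measurable f) :
    ∫⁻ y, f y ∂Measure.pi (fun _ : Fin (n + 1) => μ) =
      ∫⁻ x, ∫⁻ y, f (Fin.cons x y) ∂Measure.pi (fun _ : Fin n => μ) ∂μ := by
  rw [← lintegral_prod (fun p : E × (Fin n → E) => f (Fin.cons p.1 p.2))
    (hf.comp measurable_finCons).aemeasurable]
  have h := (measurePreserving_piFinSuccAbove (fun _ : Fin (n + 1) => μ) 0).symm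
  rw [← h.map_eq, lintegral_map hf (MeasurableEquiv.measurable _)]
  simp [MeasurableEquiv.piFinSuccAbove, Fin.insertNthEquiv]

lemma lintegral_pi_finCons' {n : ℕ} (μ : Measure E) [SigmaFinite μ]
    {f : (Fin (n + 1) → E) → ℝ≥0∞} (hf : Measurable f) :
    ∫⁻ y, f y ∂Measure.pi (fun _ : Fin (n + 1) => μ) =
      ∫⁻ y, ∫⁻ x, f (Fin.cons x y) ∂μ ∂Measure.pi (fun _ : Fin n => μ) := by
  rw [lintegral_pi_finCons μ hf, lintegral_lintegral_swap (by exact (hf.comp measurable_finCons).aemeasurable)]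

lemma lintegral_pi_comp_equiv {ι ι' : Type*} [Fintype ι] [Fintype ι'] (e : ι ≃ ι')
    (μ : Measure E) [SigmaFinite μ] {f : (ι → E) → ℝ≥0∞} (hf : Measurable f) :
    ∫⁻ y, f (fun i => y (e i)) ∂Measure.pi (fun _ : ι' => μ) =
      ∫⁻ y, f y ∂Measure.pi (fun _ : ι => μ) := by
  have hm : Measurable fun (y : ι' → E) (i : ι) => y (e i) := by fun_prop
  rw [← lintegral_map hf hm]
  congr 1
  refine (Measure.pi_eq fun s hs => ?_).symm
  rw [Measure.map_apply hm (MeasurableSet.univ_pi hs)]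
  have : (fun (y : ι' → E) (i : ι) => y (e i)) ⁻¹' Set.univ.pi s =
      Set.univ.pi fun j => s (e.symm j) := by
    ext y
    simp only [Set.mem_preimage, Set.mem_pi, Set.mem_univ, true_imp_iff]
    exact ⟨fun h j => by simpa using h (e.symm j), fun h i => by simpa using h (e i)⟩
  rw [this, Measure.pi_pi]
  exact Equiv.prod_comp e.symm (fun i => μ (s i))

end PiFin

/-! ### Exponential tilting of independent masses and of gamma random measures -/

section Tilt

/-- Tilting acts on each coordinate separately, with its own `s i`. Different values are needed
because items seen at different positions have different exposures. -/
lemma lintegral_prod_exp_mul {ι : Type*} [Fintype ι] {a s : ι → ℝ} {r : ℝ} (ha : ∀ i, 0 ≤ a i)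
    (hr : 0 < r) (hs : ∀ i, 0 ≤ s i) {f : (ι → ℝ≥0∞) → ℝ≥0∞} (hf : Measurable f) :
    ∫⁻ w, (∏ i, ENNReal.ofReal (Real.exp (-(s i * (w i).toReal)))) * f w
        ∂Measure.pi (fun i => massLaw (a i) r) =
      (∏ i, ENNReal.ofReal ((r / (r + s i)) ^ a i)) *
        ∫⁻ w, f w ∂Measure.pi (fun i => massLaw (a i) (r + s i)) := by
  have h1 := fun i => isProbabilityMeasure_massLaw (ha i) hr
  have h2 := fun i => isProbabilityMeasure_massLaw (ha i) (add_pos_of_pos_of_nonneg hr (hs i))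
  have hw : ∀ i, Measurable fun w : ℝ≥0∞ => ENNReal.ofReal (Real.exp (-(s i * w.toReal))) :=
    fun i => by fun_prop
  have hd : ∀ i, (massLaw (a i) r).withDensity
      (fun w => ENNReal.ofReal (Real.exp (-(s i * w.toReal)))) =
      ENNReal.ofReal ((r / (r + s i)) ^ a i) • massLaw (a i) (r + s i) := by
    intro i
    refine Measure.ext_of_lintegral _ fun f hf => ?_
    rw [lintegral_withDensity_eq_lintegral_mul _ (hw i) hf, lintegral_smul_measure]
    exact lintegral_exp_mul_massLaw (ha i) hr (hs i) hf
  have : ∀ i, IsFiniteMeasure ((massLaw (a i) r).withDensity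
      (fun w => ENNReal.ofReal (Real.exp (-(s i * w.toReal))))) := fun i => by
    rw [hd]; exact Measure.smul_finite _ ENNReal.ofReal_ne_top
  have h3 := pi_withDensity (fun i => massLaw (a i) r) hw
  have h4 : Measure.pi (fun i => (massLaw (a i) r).withDensity
      (fun w => ENNReal.ofReal (Real.exp (-(s i * w.toReal))))) =
      (∏ i, ENNReal.ofReal ((r / (r + s i)) ^ a i)) •
        Measure.pi (fun i => massLaw (a i) (r + s i)) := by
    refine Measure.pi_eq fun t ht => ?_
    simp [hd, Finset.prod_mul_distrib]
  rw [h4] at h3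
  have h5 := congrArg (fun ν => ∫⁻ w, f w ∂ν) h3
  rw [lintegral_smul_measure, lintegral_withDensity_eq_lintegral_mul _
    (by
      exact Finset.measurable_fun_prod _ fun i _ => (hw i).comp (measurable_pi_apply i)) hf] at h5
  exact h5.symm

lemma map_mul_pi_massLaw {ι : Type*} [Fintype ι] {a c r : ι → ℝ} (ha : ∀ i, 0 ≤ a i)
    (hr : ∀ i, 0 < r i) (hc : ∀ i, 0 < c i) :
    (Measure.pi fun i => massLaw (a i) (r i)).map (fun w i => ENNReal.ofReal (c i) * w i) =
      Measure.pi fun i => massLaw (a i) (r i / c i) := by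
  have h1 := fun i => isProbabilityMeasure_massLaw (ha i) (hr i)
  rw [Measure.pi_map_pi (f := fun i w => ENNReal.ofReal (c i) * w) (fun i => by fun_prop)]
  simp_rw [map_mul_massLaw (ha _) (hr _) (hc _)]

variable {X : Type u} [MeasurableSpace X] {μ : Measure X} {r : ℝ} {𝒦 : Measure (Measure X)}

lemma measurable_smul_measure :
    Measurable fun p : ℝ≥0∞ × Measure X => p.1 • p.2 := by
  refine Measure.measurable_of_measurable_coe _ fun s hs => ?_
  simp only [Measure.smul_apply, smul_eq_mul]
  exact measurable_fst.mul ((Measure.measurable_coe hs).comp measurable_snd)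

/-- Exponential tilting of the law of a gamma measure amounts to a rescaling. -/
lemma IsGammaMeasureLaw.withDensity_exp [IsFiniteMeasure μ] (h : IsGammaMeasureLaw μ r 𝒦)
    (hr : 0 < r) {s : ℝ} (hs : 0 ≤ s) :
    ENNReal.ofReal ((r / (r + s)) ^ μ.real Set.univ) •
        𝒦.map (fun g => ENNReal.ofReal (r / (r + s)) • g) =
      𝒦.withDensity fun g => ENNReal.ofReal (Real.exp (-(s * (g Set.univ).toReal))) := by
  have := h.isProbabilityMeasure
  have hsm : Measurable fun g : Measure X => ENNReal.ofReal (r / (r + s)) • g :=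
    measurable_smul_measure.comp (measurable_const.prodMk measurable_id)
  have : IsFiniteMeasure (ENNReal.ofReal ((r / (r + s)) ^ μ.real Set.univ) •
      𝒦.map (fun g => ENNReal.ofReal (r / (r + s)) • g)) :=
    Measure.smul_finite _ ENNReal.ofReal_ne_top
  have hrs : 0 < r + s := add_pos_of_pos_of_nonneg hr hs
  refine ext_of_cellMasses MeasurableSet.univ fun T _ q hq _ => ?_
  have hc := measurable_cellMasses hq
  refine Measure.ext_of_lintegral _ fun f hf => ?_
  have hu : Measurable fun g : Measure X => g Set.univ := Measure.measurable_coe MeasurableSet.univ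
  have hexp : Measurable fun g : Measure X =>
      ENNReal.ofReal (Real.exp (-(s * (g Set.univ).toReal))) := by
    have := hu.ennreal_toReal
    fun_prop
  rw [lintegral_map hf hc, lintegral_map hf hc, lintegral_smul_measure,
    lintegral_map (by exact hf.comp hc) hsm,
    lintegral_withDensity_eq_lintegral_mul _ hexp (by exact hf.comp hc), smul_eq_mul]
  have h1 : ∫⁻ g, f (cellMasses q (ENNReal.ofReal (r / (r + s)) • g)) ∂𝒦 =
      ∫⁻ w, f w ∂Measure.pi fun t => massLaw (μ.real (q ⁻¹' {t})) (r + s) := by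
    have := h.lintegral_cellMasses hq
      (f := fun w => f fun t => ENNReal.ofReal (r / (r + s)) * w t) (by fun_prop)
    refine Eq.trans ?_ (this.trans ?_)
    · rfl
    · rw [← lintegral_map hf (by fun_prop), map_mul_pi_massLaw (fun _ => measureReal_nonneg)
        (fun _ => hr) (fun _ => div_pos hr hrs)]
      congr 3
      funext t
      rw [div_div_cancel₀ hr.ne']
  -- The total mass is the sum of the cell masses, so the tilt is a product over cells.
  have h2 : ∀ᵐ g ∂𝒦, ENNReal.ofReal (Real.exp (-(s * (g Set.univ).toReal))) =
      ∏ t, ENNReal.ofReal (Real.exp (-(s * (cellMasses q g t).toReal))) := by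
    filter_upwards [h.ae_finite hr] with g hg
    rw [← ENNReal.ofReal_prod_of_nonneg (fun _ _ => (Real.exp_pos _).le), ← Real.exp_sum,
      Finset.sum_neg_distrib, ← Finset.mul_sum, ← ENNReal.toReal_sum]
    · simp only [cellMasses]
      rw [sum_measure_preimage_singleton _ fun t _ => hq t]
      simp
    · exact fun t _ => ((measure_mono (Set.subset_univ _)).trans_lt hg).ne
  -- The shapes of the cells add up to `μ.real Set.univ`, so the constant is the same for every
  -- partition.
  have h3 : ENNReal.ofReal ((r / (r + s)) ^ μ.real Set.univ) =
      ∏ t, ENNReal.ofReal ((r / (r + s)) ^ μ.real (q ⁻¹' {t})) := by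
    rw [← ENNReal.ofReal_prod_of_nonneg (fun _ _ => by positivity),
      ← Real.rpow_sum_of_pos (by positivity)]
    simp only [measureReal_def]
    rw [← ENNReal.toReal_sum (fun _ _ => measure_ne_top _ _),
      sum_measure_preimage_singleton _ fun t _ => hq t]
    simp
  rw [h1, h3, ← lintegral_prod_exp_mul (fun _ => measureReal_nonneg) hr (fun _ => hs) hf,
    ← h.lintegral_cellMasses hq (by fun_prop)]
  refine lintegral_congr_ae ?_
  filter_upwards [h2] with g hg
  rw [Pi.mul_apply, hg]

end Tilt

/-! ### The iterated Palm formula and the Pólya urn -/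

section IteratedPalm

variable {X : Type u} [MeasurableSpace X]

/-- The measure obtained from a measure by adding atoms with the given locations and masses. -/
def addAtoms {ι : Type*} [Fintype ι] (y : ι → X) (p : Measure X × (ι → ℝ≥0∞)) : Measure X :=
  p.1 + ∑ j, p.2 j • Measure.dirac (y j)

lemma addAtoms_apply {ι : Type*} [Fintype ι] (y : ι → X) (p : Measure X × (ι → ℝ≥0∞)) (s : Set X) :
    addAtoms y p s = p.1 s + ∑ j, p.2 j * Measure.dirac (y j) s := by
  simp [addAtoms]

lemma measurable_addAtoms {ι : Type*} [Fintype ι] :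
    Measurable fun q : (ι → X) × Measure X × (ι → ℝ≥0∞) => addAtoms q.1 q.2 := by
  refine Measure.measurable_of_measurable_coe _ fun s hs => ?_
  simp only [addAtoms_apply]
  refine ((Measure.measurable_coe hs).comp measurable_snd.fst).add
    (Finset.measurable_fun_sum _ fun j _ => ?_)
  exact ((measurable_pi_apply j).comp measurable_snd.snd).mul ((Measure.measurable_coe hs).comp
    (Measure.measurable_dirac.comp ((measurable_pi_apply j).comp measurable_fst)))

lemma measurable_addAtoms_right {ι : Type*} [Fintype ι] (y : ι → X) : Measurable (addAtoms y) :=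
  measurable_addAtoms.comp measurable_prodMk_left

lemma addAtoms_finCons {n : ℕ} (x : X) (y : Fin n → X) (g : Measure X) (w : ℝ≥0∞)
    (v : Fin n → ℝ≥0∞) :
    addAtoms (Fin.cons x y : Fin (n + 1) → X) (g, Fin.cons w v) =
      addAtoms y (g, v) + w • Measure.dirac x := by
  simp only [addAtoms, Fin.sum_univ_succ, Fin.cons_zero, Fin.cons_succ]
  abel

/-- The mass of the head atom is independent of `g` and of the other atoms, so it can be added last.
This matches the form in which `palm` and `add_atom` add their atom. -/
lemma lintegral_addAtoms_finCons {n : ℕ} (𝒦 : Measure (Measure X)) [IsProbabilityMeasure 𝒦]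
    (ρ : Measure ℝ≥0∞) [IsProbabilityMeasure ρ] (x : X) (y : Fin n → X)
    {f : Measure X → ℝ≥0∞} (hf : Measurable f) :
    ∫⁻ p, f (addAtoms (Fin.cons x y : Fin (n + 1) → X) p)
        ∂𝒦.prod (Measure.pi fun _ : Fin (n + 1) => ρ) =
      ∫⁻ p, f (p.1 + p.2 • Measure.dirac x)
        ∂((𝒦.prod (Measure.pi fun _ : Fin n => ρ)).map (addAtoms y)).prod ρ := by
  have hy := measurable_addAtoms_right y
  have hm : Measurable fun p : Measure X × ℝ≥0∞ => f (p.1 + p.2 • Measure.dirac x) :=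
    hf.comp (measurable_add_smul_dirac.comp
      (measurable_fst.prodMk (measurable_const.prodMk measurable_snd)))
  have hm2 : Measurable fun p : Measure X × (Fin (n + 1) → ℝ≥0∞) =>
      f (addAtoms (Fin.cons x y : Fin (n + 1) → X) p) := hf.comp (measurable_addAtoms_right _)
  have := Measure.isProbabilityMeasure_map (μ := 𝒦.prod (Measure.pi fun _ : Fin n => ρ))
    hy.aemeasurable
  have hm3 : Measurable fun g : Measure X => ∫⁻ w, f (g + w • Measure.dirac x) ∂ρ :=
    hm.lintegral_prod_right'
  rw [lintegral_prod _ hm.aemeasurable, lintegral_map hm3 hy,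
    lintegral_prod (fun p => f (addAtoms (Fin.cons x y : Fin (n + 1) → X) p)) hm2.aemeasurable,
    lintegral_prod _ (by exact (hm3.comp hy).aemeasurable)]
  refine lintegral_congr fun g => ?_
  rw [lintegral_pi_finCons' ρ (by exact hm2.comp measurable_prodMk_left)]
  simp_rw [addAtoms_finCons]

namespace IsGammaMeasureLaw

variable {μ : Measure X} {r : ℝ} {𝒦 : Measure (Measure X)}

/-- Iterates `add_atom`. After `n` draws the measure is again gamma with the drawn items as atoms of
its base, which lets `palm` be applied once more. -/
lemma map_addAtoms [IsFiniteMeasure μ] (h : IsGammaMeasureLaw μ r 𝒦) (hr : 0 < r) :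
    ∀ {n : ℕ} (y : Fin n → X), IsGammaMeasureLaw (μ + ∑ j, Measure.dirac (y j)) r
      ((𝒦.prod (Measure.pi fun _ : Fin n => massLaw 1 r)).map (addAtoms y)) := by
  have := h.isProbabilityMeasure
  have := isProbabilityMeasure_massLaw zero_le_one hr
  intro n
  induction n with
  | zero =>
    intro y
    have : addAtoms y = Prod.fst := by funext p; simp [addAtoms]
    rw [this, ← Measure.fst, Measure.fst_prod]
    simpa using h
  | succ n ih =>
    intro y
    obtain ⟨x, y, rfl⟩ : ∃ x y', y = Fin.cons x y' := ⟨y 0, Fin.tail y, (Fin.cons_self_tail y).symm⟩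
    have e := (ih y).add_atom hr x
    have e1 : μ + ∑ j, Measure.dirac (y j) + Measure.dirac x =
        μ + ∑ j, Measure.dirac ((Fin.cons x y : Fin (n + 1) → X) j) := by
      rw [Fin.sum_univ_succ]
      simp only [Fin.cons_zero, Fin.cons_succ]
      abel
    rw [e1] at e
    convert e using 1
    refine Measure.ext_of_lintegral _ fun f hf => ?_
    rw [lintegral_map hf (measurable_addAtoms_right _), lintegral_addAtoms_finCons _ _ _ _ hf,
      lintegral_map hf (by
        exact measurable_add_smul_dirac.comp (measurable_fst.prodMk (measurable_const.prodMk measurable_snd)))]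

/-- The kernel `y ↦ r⁻¹ (μ + ∑ j, δ_{y j})`, which is proportional to the predictive distribution
of a Pólya urn. -/
def polyaKernel (μ : Measure X) [IsFiniteMeasure μ] (r : ℝ) (n : ℕ) : Kernel (Fin n → X) X where
  toFun y := ENNReal.ofReal r⁻¹ • (μ + ∑ j, Measure.dirac (y j))
  measurable' := by
    refine Measure.measurable_of_measurable_coe _ fun s hs => ?_
    simp only [Measure.smul_apply, Measure.add_apply, Measure.finsetSum_apply]
    have : Measurable fun y : Fin n → X => ∑ j, Measure.dirac (y j) s := by
      refine Finset.measurable_fun_sum _ fun j _ => ?_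
      exact (Measure.measurable_coe hs).comp (Measure.measurable_dirac.comp (measurable_pi_apply j))
    exact (this.const_add (μ s)).const_smul (ENNReal.ofReal r⁻¹)

lemma polyaKernel_apply (μ : Measure X) [IsFiniteMeasure μ] (r : ℝ) (n : ℕ) (y : Fin n → X) :
    polyaKernel μ r n y = ENNReal.ofReal r⁻¹ • (μ + ∑ j, Measure.dirac (y j)) := rfl

instance (μ : Measure X) [IsFiniteMeasure μ] (r : ℝ) (n : ℕ) :
    IsFiniteKernel (polyaKernel μ r n) := by
  refine ⟨ENNReal.ofReal r⁻¹ * (μ Set.univ + n), ?_, fun y => ?_⟩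
  · exact ENNReal.mul_lt_top ENNReal.ofReal_lt_top (by simp)
  · simp [polyaKernel_apply, mul_add]

lemma measurable_lintegral_normalize {B : Type*} [MeasurableSpace B] {f : X → B × Measure X → ℝ≥0∞}
    (hf : Measurable (Function.uncurry f)) :
    Measurable fun p : B × Measure X => ∫⁻ x, f x p ∂normalize p.2 := by
  have : Measurable fun q : (B × Measure X) × X => f q.2 q.1 := hf.comp measurable_swap
  exact Measurable.lintegral_kernel_prod_right'
    (κ := normalize.comap Prod.snd measurable_snd) this

/-- Iterated Palm formula for gamma measures. -/
theorem palm_fin [IsFiniteMeasure μ] (h : IsGammaMeasureLaw μ r 𝒦) (hr : 0 < r) (n : ℕ) :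
    ∃ Q : Measure (Fin n → X), IsFiniteMeasure Q ∧
      ∀ f : (Fin n → X) → Measure X → ℝ≥0∞, Measurable (Function.uncurry f) →
        ∫⁻ g, g Set.univ ^ n * ∫⁻ y, f y g ∂Measure.pi (fun _ : Fin n => normalize g) ∂𝒦 =
          ∫⁻ y, ∫⁻ p, f y (addAtoms y p)
            ∂𝒦.prod (Measure.pi fun _ : Fin n => massLaw 1 r) ∂Q := by
  have := h.isProbabilityMeasure
  have := isProbabilityMeasure_massLaw zero_le_one hr
  induction n with
  | zero =>
    refine ⟨Measure.dirac Fin.elim0, inferInstance, fun f hf => ?_⟩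
    have h1 : ∀ p : Measure X × (Fin 0 → ℝ≥0∞), addAtoms Fin.elim0 p = p.1 := by
      intro p; simp [addAtoms]
    have hf0 : Measurable (f Fin.elim0) := hf.comp measurable_prodMk_left
    have h2 : Measurable fun y : Fin 0 → X => ∫⁻ p, f y (addAtoms y p)
            ∂𝒦.prod (Measure.pi fun _ : Fin 0 => massLaw 1 r) :=
      Measurable.lintegral_prod_right' (f := fun q : (Fin 0 → X) × Measure X × (Fin 0 → ℝ≥0∞) =>
        f q.1 (addAtoms q.1 q.2)) (hf.comp (measurable_fst.prodMk measurable_addAtoms))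
    rw [lintegral_dirac' _ h2]
    simp_rw [h1]
    rw [lintegral_prod _ (by exact (hf0.comp measurable_fst).aemeasurable)]
    simp [Measure.pi_of_empty _ Fin.elim0, lintegral_dirac' _
      (show Measurable fun y => f y _ from hf.comp measurable_prodMk_right)]
  | succ n ih =>
    obtain ⟨Q, hQ, ih⟩ := ih
    -- Given the earlier items `y`, the next one has intensity `r⁻¹ (μ + ∑ δ_{y j})`. It is placed
    -- at the head of the list.
    refine ⟨(Q ⊗ₘ polyaKernel μ r n).map fun p => Fin.cons p.2 p.1,
      Measure.isFiniteMeasure_map _ _, fun f hf => ?_⟩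
    have hcons : Measurable fun p : (Fin n → X) × X => (Fin.cons p.2 p.1 : Fin (n + 1) → X) :=
      measurable_finCons.comp measurable_swap
    have hu : Measurable fun g : Measure X => g Set.univ :=
      Measure.measurable_coe MeasurableSet.univ
    have hf1 : Measurable fun p : (Fin n → X) × Measure X =>
        ∫⁻ x, f (Fin.cons x p.1) p.2 ∂normalize p.2 := by
      refine measurable_lintegral_normalize
        (f := fun x (p : (Fin n → X) × Measure X) => f (Fin.cons x p.1) p.2) ?_
      exact hf.comp ((hcons.comp (measurable_snd.fst.prodMk measurable_fst)).prodMk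
        measurable_snd.snd)
    have hf2 : Measurable fun p : (Fin n → X) × Measure X =>
        p.2 Set.univ * ∫⁻ x, f (Fin.cons x p.1) p.2 ∂normalize p.2 :=
      (hu.comp measurable_snd).mul hf1
    have hΦ : Measurable fun y : Fin (n + 1) → X => ∫⁻ p, f y (addAtoms y p)
            ∂𝒦.prod (Measure.pi fun _ : Fin (n + 1) => massLaw 1 r) :=
      Measurable.lintegral_prod_right'
        (f := fun q : (Fin (n + 1) → X) × Measure X × (Fin (n + 1) → ℝ≥0∞) =>
          f q.1 (addAtoms q.1 q.2))
        (hf.comp (measurable_fst.prodMk measurable_addAtoms))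
    rw [lintegral_map hΦ hcons, Measure.lintegral_compProd (by exact hΦ.comp hcons)]
    -- The innermost draw, weighted by one factor of the total mass, is made part of the test
    -- function, so that `n` draws remain for the induction hypothesis.
    have ih' := ih (fun y g => g Set.univ * ∫⁻ x, f (Fin.cons x y) g ∂normalize g) hf2
    refine Eq.trans ?_ (ih'.trans ?_)
    · refine lintegral_congr fun g => ?_
      have hg1 : Measurable fun y => f y g := hf.comp measurable_prodMk_right
      have hg2 : Measurable fun y : Fin n → X => ∫⁻ x, f (Fin.cons x y) g ∂normalize g :=
        (hg1.comp hcons).lintegral_prod_right'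
      rw [lintegral_pi_finCons' (normalize g) hg1, pow_succ, mul_assoc, lintegral_const_mul _ hg2]
    · refine lintegral_congr fun y => ?_
      rw [polyaKernel_apply, lintegral_smul_measure, smul_eq_mul]
      -- The measure carrying the atoms at `y` is gamma with base `μ + ∑ δ_{y j}`, and the one-step
      -- formula handles the remaining draw.
      have hy := h.map_addAtoms hr y
      have hfy : Measurable (Function.uncurry fun (x : X) (g : Measure X) =>
          f (Fin.cons x y) g) := by
        have hc : Measurable fun x : X => (Fin.cons x y : Fin (n + 1) → X) :=
          hcons.comp measurable_prodMk_left
        exact hf.comp ((hc.comp measurable_fst).prodMk measurable_snd)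
      have := hy.palm hr hfy
      rw [lintegral_map (by exact hf2.comp measurable_prodMk_left)
        (measurable_addAtoms_right y)] at this
      rw [this]
      congr 1
      refine lintegral_congr fun x => ?_
      rw [lintegral_addAtoms_finCons]
      exact hf.comp measurable_prodMk_left

/-- Transport along an enumeration. The index type needed later is the set of pairs (ranking,
position). -/
theorem palm_pi [IsFiniteMeasure μ] (h : IsGammaMeasureLaw μ r 𝒦) (hr : 0 < r)
    (ι : Type*) [Fintype ι] :
    ∃ Q : Measure (ι → X), IsFiniteMeasure Q ∧
      ∀ f : (ι → X) → Measure X → ℝ≥0∞, Measurable (Function.uncurry f) →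
        ∫⁻ g, g Set.univ ^ Fintype.card ι *
            ∫⁻ y, f y g ∂Measure.pi (fun _ : ι => normalize g) ∂𝒦 =
          ∫⁻ y, ∫⁻ p, f y (addAtoms y p)
            ∂𝒦.prod (Measure.pi fun _ : ι => massLaw 1 r) ∂Q := by
  have := h.isProbabilityMeasure
  have := isProbabilityMeasure_massLaw zero_le_one hr
  let e := Fintype.equivFin ι
  obtain ⟨Q, hQ, hp⟩ := h.palm_fin hr (Fintype.card ι)
  have hm : Measurable fun (y : Fin (Fintype.card ι) → X) (i : ι) => y (e i) := by fun_prop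
  refine ⟨Q.map fun y i => y (e i), Measure.isFiniteMeasure_map _ _, fun f hf => ?_⟩
  have hm2 : Measurable fun q : (ι → X) × Measure X × (ι → ℝ≥0∞) =>
        f q.1 (addAtoms q.1 q.2) :=
    hf.comp (measurable_fst.prodMk measurable_addAtoms)
  have hΦ : Measurable fun y : ι → X => ∫⁻ p, f y (addAtoms y p)
      ∂𝒦.prod (Measure.pi fun _ : ι => massLaw 1 r) := Measurable.lintegral_prod_right' hm2
  rw [lintegral_map hΦ hm]
  refine Eq.trans ?_ ((hp (fun y g => f (fun i => y (e i)) g) (hf.comp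
    ((hm.comp measurable_fst).prodMk measurable_snd))).trans ?_)
  · refine lintegral_congr fun g => ?_
    rw [← lintegral_pi_comp_equiv e (normalize g) (by exact hf.comp measurable_prodMk_right)]
  · refine lintegral_congr fun y => ?_
    have hm3 : Measurable fun p : Measure X × (ι → ℝ≥0∞) =>
        f (fun i => y (e i)) (addAtoms (fun i => y (e i)) p) :=
      hm2.comp measurable_prodMk_left
    rw [lintegral_prod _ hm3.aemeasurable, lintegral_prod _ (by
      exact (hf.comp (measurable_const.prodMk (measurable_addAtoms_right y))).aemeasurable)]
    refine lintegral_congr fun g => ?_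
    rw [← lintegral_pi_comp_equiv e _ (by exact hm3.comp measurable_prodMk_left)]
    refine lintegral_congr fun v => ?_
    congr 1
    simp only [addAtoms]
    rw [← Equiv.sum_comp e]

end IsGammaMeasureLaw

end IteratedPalm

end

end RankingModel

namespace RankingModel

noncomputable section

universe u

/-! ### Densities of the rankings and of the waiting times -/

section Rankings

variable {X : Type u} [MeasurableSpace X]

/-- Finite measures which are not carried by a finite set of items. -/
structure HasInfiniteSupport (g : Measure X) : Prop where
  finite : g Set.univ < ∞
  compl_ne_zero : ∀ F : Set X, F.Finite → g Fᶜ ≠ 0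

lemma HasInfiniteSupport.univ_ne_zero {g : Measure X} (h : HasInfiniteSupport g) :
    g Set.univ ≠ 0 := by
  simpa using h.compl_ne_zero ∅ Set.finite_empty

lemma HasInfiniteSupport.isFiniteMeasure {g : Measure X} (h : HasInfiniteSupport g) :
    IsFiniteMeasure g := ⟨h.finite⟩

lemma lintegral_normalize (g : Measure X) (f : X → ℝ≥0∞) :
    ∫⁻ x, f x ∂normalize g = (g Set.univ)⁻¹ * ∫⁻ x, f x ∂g := by
  change ∫⁻ x, f x ∂((g Set.univ)⁻¹ • g) = _
  rw [lintegral_smul_measure, smul_eq_mul]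

/-- Bridges the powers of `g` in the ranking density and the weighted powers of `normalize g` in the
Palm formula. -/
lemma pi_eq_smul_pi_normalize {ι : Type*} [Fintype ι] {g : Measure X} (h : HasInfiniteSupport g) :
    Measure.pi (fun _ : ι => g) =
      g Set.univ ^ Fintype.card ι • Measure.pi (fun _ : ι => normalize g) := by
  have := h.isFiniteMeasure
  refine Measure.pi_eq fun s hs => ?_
  rw [Measure.smul_apply, Measure.pi_pi, smul_eq_mul, ← Finset.card_univ, ← Finset.prod_const,
    ← Finset.prod_mul_distrib]
  refine Finset.prod_congr rfl fun i _ => ?_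
  rw [normalize_apply, ← mul_assoc, ENNReal.mul_inv_cancel h.univ_ne_zero h.finite.ne, one_mul]

lemma lintegral_pi_pi {E : Type*} [MeasurableSpace E] {ι : Type*} [Fintype ι] {ι' : ι → Type*}
    [∀ i, Fintype (ι' i)] (μ : Measure E) [SigmaFinite μ] {f : (∀ i, ι' i → E) → ℝ≥0∞}
    (hf : Measurable f) :
    ∫⁻ y, f y ∂Measure.pi (fun i => Measure.pi fun _ : ι' i => μ) =
      ∫⁻ y, f (fun i j => y ⟨i, j⟩) ∂Measure.pi (fun _ : (i : ι) × ι' i => μ) := by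
  have hm : Measurable fun (y : (i : ι) × ι' i → E) i (j : ι' i) => y ⟨i, j⟩ := by fun_prop
  rw [← lintegral_map hf hm]
  congr 1
  have hg : (Measure.pi fun i => Measure.pi fun _ : ι' i => μ).map
      (fun y (p : (i : ι) × ι' i) => y p.1 p.2) = Measure.pi fun _ : (i : ι) × ι' i => μ := by
    refine (Measure.pi_eq fun s hs => ?_).symm
    rw [Measure.map_apply (by fun_prop) (MeasurableSet.univ_pi hs)]
    have : (fun (y : ∀ i, ι' i → E) (p : (i : ι) × ι' i) => y p.1 p.2) ⁻¹' Set.univ.pi s =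
        Set.univ.pi fun i => Set.univ.pi fun j => s ⟨i, j⟩ := by
      ext y
      simp [Sigma.forall]
    rw [this, Measure.pi_pi]
    simp_rw [Measure.pi_pi]
    rw [Fintype.prod_sigma]
  rw [← hg, Measure.map_map hm (by fun_prop)]
  exact Measure.map_id.symm

lemma remainingMass_eq {g : Measure X} (h : g Set.univ < ∞) {m : ℕ} (i : Fin m) (y : Fin m → X) :
    remainingMass i (g, y) = (g {x | ∀ j < i, y j ≠ x}).toReal := by
  simp [remainingMass, h]

lemma ofReal_remainingMass {g : Measure X} (h : g Set.univ < ∞) {m : ℕ} (i : Fin m)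
    (y : Fin m → X) :
    ENNReal.ofReal (remainingMass i (g, y)) = g {x | ∀ j < i, y j ≠ x} := by
  rw [remainingMass_eq h, ENNReal.ofReal_toReal]
  exact ((measure_mono (Set.subset_univ _)).trans_lt h).ne

/-- Finitely many removed items cannot exhaust `g`. Hence every exponential rate is positive, and
the waiting times have genuine probability laws. -/
lemma remainingMass_pos {g : Measure X} (h : HasInfiniteSupport g) {m : ℕ} (i : Fin m)
    (y : Fin m → X) : 0 < remainingMass i (g, y) := by
  rw [remainingMass_eq h.finite]
  refine ENNReal.toReal_pos ?_ ((measure_mono (Set.subset_univ _)).trans_lt h.finite).ne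
  convert h.compl_ne_zero (y '' {j | j < i}) (Set.toFinite _) using 2
  ext x
  simp

variable [MeasurableEq X]

lemma measurableSet_injective (m : ℕ) : MeasurableSet {y : Fin m → X | Function.Injective y} := by
  have : {y : Fin m → X | Function.Injective y} =
      ⋂ i, ⋂ j, {y : Fin m → X | i ≠ j → y i ≠ y j} := by
    ext y
    simp only [Set.mem_ofPred_eq, Set.mem_iInter, Function.Injective, ne_eq]
    exact forall_congr' fun i => forall_congr' fun j => not_imp_not.symm
  rw [this]
  refine MeasurableSet.iInter fun i => MeasurableSet.iInter fun j => ?_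
  by_cases hij : i = j
  · simp [hij]
  · simp only [ne_eq, hij, not_false_eq_true, true_imp_iff]
    exact (measurableSet_eq_fun (measurable_pi_apply i) (measurable_pi_apply j)).compl

lemma HasInfiniteSupport.removeItem {g : Measure X} (h : HasInfiniteSupport g) (x : X) :
    HasInfiniteSupport (removeItem (g, x)) := by
  rw [RankingModel.removeItem, if_pos h.finite]
  refine ⟨(Measure.restrict_apply_le _ _).trans_lt h.finite, fun F hF => ?_⟩
  rw [Measure.restrict_apply hF.measurableSet.compl, ← Set.compl_union]
  exact h.compl_ne_zero _ (hF.union (Set.finite_singleton x))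

/-- The density of the Plackett–Luce model. -/
lemma lintegral_plackettLuce {m : ℕ} :
    ∀ {g : Measure X}, HasInfiniteSupport g → ∀ {f : (Fin m → X) → ℝ≥0∞}, Measurable f →
    ∫⁻ y, (∏ i, ENNReal.ofReal (remainingMass i (g, y))) * f y ∂plackettLuce m g =
      ∫⁻ y, {y | Function.Injective y}.indicator f y ∂Measure.pi fun _ : Fin m => g := by
  have hR : ∀ {m : ℕ} (g : Measure X), Measurable fun y : Fin m → X =>
      ∏ i, ENNReal.ofReal (remainingMass i (g, y)) := fun g =>
    Finset.measurable_fun_prod _ fun i _ =>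
      ((measurable_remainingMass i).comp measurable_prodMk_left).ennreal_ofReal
  induction m with
  | zero =>
    intro g hg f hf
    have h : (fun y : Fin 0 → X => {y | Function.Injective y}.indicator f y) = f := by
      funext y
      exact Set.indicator_of_mem (Function.injective_of_subsingleton y) f
    rw [h]
    simp [plackettLuce, Measure.pi_of_empty _ Fin.elim0, lintegral_dirac' _ hf]
  | succ m ih =>
    intro g hg f hf
    have := hg.isFiniteMeasure
    have hcons := measurable_finCons (E := X) (n := m)
    have hi := hf.indicator (measurableSet_injective (X := X) (m + 1))
    have hRf : Measurable fun y : Fin (m + 1) → X =>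
        (∏ i, ENNReal.ofReal (remainingMass i (g, y))) * f y := (hR g).mul hf
    rw [plackettLuce, Kernel.lintegral_map _ hcons _ hRf,
      Kernel.lintegral_compProd _ _ _ (by exact hRf.comp hcons), lintegral_normalize,
      lintegral_pi_finCons g hi]
    rw [← lintegral_const_mul']
    swap
    · simpa using hg.univ_ne_zero
    refine lintegral_congr fun x => ?_
    have hx := hg.removeItem x
    have hfx : Measurable fun y : Fin m → X => f (Fin.cons x y) :=
      hf.comp (hcons.comp measurable_prodMk_left)
    -- The first remaining mass is the whole of `g`; the later ones are those of the tail with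
    -- respect to `g` with `x` removed. The first factor then cancels the normalization of the first
    -- draw.
    have h1 : ∀ y : Fin m → X,
        ∏ i, ENNReal.ofReal (remainingMass i (g, (Fin.cons x y : Fin (m + 1) → X))) =
          g Set.univ * ∏ i, ENNReal.ofReal (remainingMass i (removeItem (g, x), y)) := by
      intro y
      rw [Fin.prod_univ_succ]
      congr 1
      · rw [ofReal_remainingMass hg.finite]
        congr 1
        ext; simp
      · refine Finset.prod_congr rfl fun i _ => ?_
        rw [ofReal_remainingMass hg.finite, ofReal_remainingMass hx.finite, removeItem,
          if_pos hg.finite, Measure.restrict_apply']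
        · congr 1
          ext x'
          simp only [Set.mem_ofPred_eq, Set.mem_inter_iff, Set.mem_compl_iff,
            Set.mem_singleton_iff]
          constructor
          · refine fun h => ⟨fun j hj => by simpa using h j.succ (Fin.succ_lt_succ_iff.2 hj), ?_⟩
            simpa [eq_comm] using h 0 (Fin.succ_pos i)
          · rintro ⟨h, h0⟩ j hj
            induction j using Fin.cases with
            | zero => simpa [eq_comm] using h0
            | succ j => simpa using h j (Fin.succ_lt_succ_iff.1 hj)
        · exact (measurableSet_singleton x).compl
    change (g Set.univ)⁻¹ * ∫⁻ y, (∏ i, ENNReal.ofReal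
      (remainingMass i (g, (Fin.cons x y : Fin (m + 1) → X)))) * f (Fin.cons x y)
        ∂plackettLuce m (removeItem (g, x)) = _
    simp_rw [h1, mul_assoc]
    rw [lintegral_const_mul _ (by exact (hR _).mul hfx), ← mul_assoc,
      ENNReal.inv_mul_cancel hg.univ_ne_zero hg.finite.ne, one_mul, ih hx hfx, removeItem,
      if_pos hg.finite, ← Measure.restrict_pi_pi, ← lintegral_indicator
      (MeasurableSet.univ_pi fun _ => (measurableSet_singleton x).compl)]
    refine lintegral_congr fun y => ?_
    -- Restricting `g` to `{x}ᶜ` forces the tail to avoid `x`; together with injectivity of the tail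
    -- this is injectivity of the whole list.
    by_cases h2 : y ∈ Set.univ.pi fun _ : Fin m => ({x}ᶜ : Set X)
    · rw [Set.indicator_of_mem h2]
      have : x ∉ Set.range y := by simpa [Set.mem_pi] using h2
      by_cases h3 : Function.Injective y
      · rw [Set.indicator_of_mem (by exact h3), Set.indicator_of_mem]
        exact Fin.cons_injective_iff.2 ⟨this, h3⟩
      · rw [Set.indicator_of_notMem (by exact h3), Set.indicator_of_notMem]
        exact fun h => h3 (Fin.cons_injective_iff.1 h).2
    · rw [Set.indicator_of_notMem h2, Set.indicator_of_notMem]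
      refine fun h => h2 ?_
      have := (Fin.cons_injective_iff.1 h).1
      simpa [Set.mem_pi] using this

variable {L : ℕ} {m : Fin L → ℕ}

/-- The rankings are independent given `g`, so the identities `lintegral_plackettLuce` for the
single lists multiply. -/
lemma lintegral_rankingsKernel {g : Measure X} (hg : HasInfiniteSupport g)
    {f : (∀ ℓ, Fin (m ℓ) → X) → ℝ≥0∞} (hf : Measurable f) :
    ∫⁻ y, (∏ ℓ, ∏ i, ENNReal.ofReal (remainingMass i (g, y ℓ))) * f y ∂rankingsKernel m g =
      ∫⁻ y, {y | ∀ ℓ, Function.Injective (y ℓ)}.indicator f y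
        ∂Measure.pi fun ℓ => Measure.pi fun _ : Fin (m ℓ) => g := by
  have := hg.isFiniteMeasure
  have hR : ∀ ℓ, Measurable fun y : Fin (m ℓ) → X =>
      ∏ i, ENNReal.ofReal (remainingMass i (g, y)) := fun ℓ =>
    Finset.measurable_fun_prod _ fun i _ =>
      ((measurable_remainingMass i).comp measurable_prodMk_left).ennreal_ofReal
  have hd : ∀ ℓ, (plackettLuce (m ℓ) g).withDensity
      (fun y => ∏ i, ENNReal.ofReal (remainingMass i (g, y))) =
      (Measure.pi fun _ : Fin (m ℓ) => g).restrict {y | Function.Injective y} := by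
    intro ℓ
    refine Measure.ext_of_lintegral _ fun f hf => ?_
    rw [lintegral_withDensity_eq_lintegral_mul _ (hR ℓ) hf,
      ← lintegral_indicator (measurableSet_injective _)]
    exact lintegral_plackettLuce hg hf
  have : ∀ ℓ, IsFiniteMeasure ((plackettLuce (m ℓ) g).withDensity
      (fun y => ∏ i, ENNReal.ofReal (remainingMass i (g, y)))) := fun ℓ => by
    rw [hd]; infer_instance
  have h := pi_withDensity (fun ℓ => plackettLuce (m ℓ) g) hR
  simp_rw [hd] at h
  rw [← Measure.restrict_pi_pi] at h
  have h2 := congrArg (fun ν => ∫⁻ y, f y ∂ν) h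
  have hs : (Set.univ.pi fun ℓ : Fin L => {y : Fin (m ℓ) → X | Function.Injective y}) =
      {y | ∀ ℓ, Function.Injective (y ℓ)} := by ext y; simp
  rw [← lintegral_indicator (MeasurableSet.univ_pi fun ℓ => measurableSet_injective _), hs,
    lintegral_withDensity_eq_lintegral_mul _ (by
      exact Finset.measurable_fun_prod _ fun ℓ _ => (hR ℓ).comp (measurable_pi_apply ℓ)) hf] at h2
  exact h2.symm

/-- The joint density of the rankings and the inter-arrival times. -/
def jointDensity (g : Measure X) (y : ∀ ℓ, Fin (m ℓ) → X) (z : ∀ ℓ, Fin (m ℓ) → ℝ) : ℝ≥0∞ :=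
  {z : ∀ ℓ, Fin (m ℓ) → ℝ | ∀ ℓ i, 0 ≤ z ℓ i}.indicator
    (fun z => ENNReal.ofReal (Real.exp (-∑ ℓ, ∑ i, remainingMass i (g, y ℓ) * z ℓ i))) z

lemma measurableSet_nonneg :
    MeasurableSet {z : ∀ ℓ, Fin (m ℓ) → ℝ | ∀ ℓ i, 0 ≤ z ℓ i} := by
  have : {z : ∀ ℓ, Fin (m ℓ) → ℝ | ∀ ℓ i, 0 ≤ z ℓ i} =
      ⋂ ℓ, ⋂ i, {z : ∀ ℓ, Fin (m ℓ) → ℝ | 0 ≤ z ℓ i} := by ext; simp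
  rw [this]
  exact MeasurableSet.iInter fun ℓ => MeasurableSet.iInter fun i =>
    measurableSet_le measurable_const (by fun_prop)

lemma measurable_jointDensity :
    Measurable fun p : Measure X × (∀ ℓ, Fin (m ℓ) → X) × (∀ ℓ, Fin (m ℓ) → ℝ) =>
      jointDensity p.1 p.2.1 p.2.2 := by
  classical
  simp only [jointDensity, Set.indicator_apply]
  refine Measurable.ite (measurableSet_nonneg.preimage measurable_snd.snd) ?_ measurable_const
  refine (Real.measurable_exp.comp (Measurable.neg ?_)).ennreal_ofReal
  refine Finset.measurable_fun_sum _ fun ℓ _ => Finset.measurable_fun_sum _ fun i _ => ?_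
  refine ((measurable_remainingMass i).comp
    (measurable_fst.prodMk ((measurable_pi_apply ℓ).comp measurable_snd.fst))).mul ?_
  fun_prop

/-- The product Lebesgue measure on the space of inter-arrival times. -/
def arrivalVolume (m : Fin L → ℕ) : Measure (∀ ℓ, Fin (m ℓ) → ℝ) :=
  Measure.pi fun ℓ => Measure.pi fun _ : Fin (m ℓ) => volume

instance : SigmaFinite (arrivalVolume m) := by unfold arrivalVolume; infer_instance

/-- The prefactors of the exponential densities are kept outside the integral because they are
exactly the denominators of the Plackett–Luce probabilities. -/
lemma lintegral_arrivalKernel {g : Measure X} (hg : HasInfiniteSupport g)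
    (y : ∀ ℓ, Fin (m ℓ) → X) {f : (∀ ℓ, Fin (m ℓ) → ℝ) → ℝ≥0∞} (hf : Measurable f) :
    ∫⁻ z, f z ∂arrivalKernel m (g, y) =
      (∏ ℓ, ∏ i, ENNReal.ofReal (remainingMass i (g, y ℓ))) *
        ∫⁻ z, jointDensity g y z * f z ∂arrivalVolume m := by
  have hp : ∀ ℓ i, IsProbabilityMeasure
      ((volume : Measure ℝ).withDensity (gammaPDF 1 (remainingMass i (g, y ℓ)))) := fun ℓ i =>
    isProbabilityMeasure_gammaMeasure one_pos (remainingMass_pos hg i (y ℓ))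
  have h1 : ∀ ℓ, (Measure.pi fun i =>
      (volume : Measure ℝ).withDensity (gammaPDF 1 (remainingMass i (g, y ℓ)))) =
      (Measure.pi fun _ : Fin (m ℓ) => (volume : Measure ℝ)).withDensity
        fun z => ∏ i, gammaPDF 1 (remainingMass i (g, y ℓ)) (z i) := fun ℓ =>
    pi_withDensity _ fun i => measurable_gammaPDF _ _
  have hw : ∀ ℓ, Measurable fun z : Fin (m ℓ) → ℝ =>
      ∏ i, gammaPDF 1 (remainingMass i (g, y ℓ)) (z i) := fun ℓ =>
    Finset.measurable_fun_prod _ fun i _ => (measurable_gammaPDF _ _).comp (measurable_pi_apply i)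
  have hp2 : ∀ ℓ, IsProbabilityMeasure
      ((Measure.pi fun _ : Fin (m ℓ) => (volume : Measure ℝ)).withDensity
        fun z => ∏ i, gammaPDF 1 (remainingMass i (g, y ℓ)) (z i)) := fun ℓ => by
    rw [← h1]; infer_instance
  have h2 : arrivalKernel m (g, y) = (arrivalVolume m).withDensity
      fun z => ∏ ℓ, ∏ i, gammaPDF 1 (remainingMass i (g, y ℓ)) (z ℓ i) := by
    change Measure.pi (fun ℓ => Measure.pi fun i =>
      (volume : Measure ℝ).withDensity (gammaPDF 1 (remainingMass i (g, y ℓ)))) = _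
    simp_rw [h1]
    exact pi_withDensity _ hw
  have hJ : Measurable fun z => jointDensity g y z * f z :=
    (measurable_jointDensity.comp (measurable_prodMk_left.comp measurable_prodMk_left)).mul hf
  rw [h2, lintegral_withDensity_eq_lintegral_mul _ (by
    exact Finset.measurable_fun_prod _ fun ℓ _ => (hw ℓ).comp (measurable_pi_apply ℓ)) hf,
    ← lintegral_const_mul _ hJ]
  refine lintegral_congr fun z => ?_
  rw [Pi.mul_apply, ← mul_assoc]
  congr 1
  by_cases hz : ∀ ℓ i, 0 ≤ z ℓ i
  · rw [jointDensity, Set.indicator_of_mem (by exact hz), ← Finset.sum_neg_distrib]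
    simp_rw [← Finset.sum_neg_distrib]
    rw [Real.exp_sum, ENNReal.ofReal_prod_of_nonneg (fun _ _ => (Real.exp_pos _).le),
      ← Finset.prod_mul_distrib]
    refine Finset.prod_congr rfl fun ℓ _ => ?_
    rw [Real.exp_sum, ENNReal.ofReal_prod_of_nonneg (fun _ _ => (Real.exp_pos _).le),
      ← Finset.prod_mul_distrib]
    refine Finset.prod_congr rfl fun i _ => ?_
    rw [gammaPDF_of_nonneg (hz ℓ i), ← ENNReal.ofReal_mul (remainingMass_pos hg i _).le]
    simp
  · rw [jointDensity, Set.indicator_of_notMem (by exact hz), mul_zero]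
    push Not at hz
    obtain ⟨ℓ, i, hz⟩ := hz
    exact Finset.prod_eq_zero (Finset.mem_univ ℓ)
      (Finset.prod_eq_zero (Finset.mem_univ i) (gammaPDF_of_neg hz))

/-- The joint law of the rankings and the inter-arrival times has a density with respect to the
measure that draws all items independently from `g`. -/
lemma lintegral_rankingsKernel_arrivalKernel {g : Measure X} (hg : HasInfiniteSupport g)
    {f : (∀ ℓ, Fin (m ℓ) → X) → (∀ ℓ, Fin (m ℓ) → ℝ) → ℝ≥0∞}
    (hf : Measurable (Function.uncurry f)) :
    ∫⁻ y, ∫⁻ z, f y z ∂arrivalKernel m (g, y) ∂rankingsKernel m g =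
      g Set.univ ^ Fintype.card ((ℓ : Fin L) × Fin (m ℓ)) *
        ∫⁻ y, {y | ∀ ℓ, Function.Injective (y ℓ)}.indicator
          (fun y => ∫⁻ z, jointDensity g y z * f y z ∂arrivalVolume m) (fun ℓ i => y ⟨ℓ, i⟩)
          ∂Measure.pi fun _ : (ℓ : Fin L) × Fin (m ℓ) => normalize g := by
  have := hg.isFiniteMeasure
  have hF : Measurable fun y => ∫⁻ z, jointDensity g y z * f y z ∂arrivalVolume m :=
    Measurable.lintegral_prod_right'
      (f := fun p : (∀ ℓ, Fin (m ℓ) → X) × (∀ ℓ, Fin (m ℓ) → ℝ) => jointDensity g p.1 p.2 * f p.1 p.2)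
      ((measurable_jointDensity.comp measurable_prodMk_left).mul hf)
  have hinj : MeasurableSet {y : ∀ ℓ, Fin (m ℓ) → X | ∀ ℓ, Function.Injective (y ℓ)} := by
    convert MeasurableSet.univ_pi fun ℓ => measurableSet_injective (X := X) (m ℓ) using 1
    ext y; simp
  simp_rw [fun y => lintegral_arrivalKernel hg y (f := f y) (hf.comp measurable_prodMk_left)]
  -- The product of rates cancels against the Plackett–Luce denominators, leaving a power of `g` on
  -- lists without repetition.
  rw [lintegral_rankingsKernel hg hF, lintegral_pi_pi g (hF.indicator hinj),
    pi_eq_smul_pi_normalize hg, lintegral_smul_measure, smul_eq_mul]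

end Rankings

end

end RankingModel

namespace RankingModel

noncomputable section

universe u

/-! ### Merging repeated occurrences of an item -/

section Grouping

/-- Sums of disjoint groups of independent exponential variables with common rates within each
group are independent gamma variables. -/
lemma map_sum_fiber_pi_massLaw {ι T : Type*} [Fintype ι] [Fintype T] [DecidableEq T] (c : ι → T)
    {r : T → ℝ} (hr : ∀ t, 0 < r t) :
    (Measure.pi fun j => massLaw 1 (r (c j))).map (fun v t => ∑ j with c j = t, v j) =
      Measure.pi fun t => massLaw (Finset.card {j | c j = t} : ℕ) (r t) := by
  classical
  have h1 := fun j => isProbabilityMeasure_massLaw zero_le_one (hr (c j))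
  have h0 := fun t (n : ℕ) => isProbabilityMeasure_massLaw (Nat.cast_nonneg n) (hr t)
  have hm : ∀ S : Finset ι, Measurable fun (v : ι → ℝ≥0∞) t => ∑ j ∈ S with c j = t, v j :=
    fun S => measurable_pi_lambda _ fun t => Finset.measurable_fun_sum _ fun j _ =>
      measurable_pi_apply j
  -- Induction on the set of exponentials already summed. A group without summands has shape `0`,
  -- hence the point mass at `0`.
  suffices h : ∀ S : Finset ι, ∀ f : (T → ℝ≥0∞) → ℝ≥0∞, Measurable f →
      ∫⁻ v, f (fun t => ∑ j ∈ S with c j = t, v j) ∂(Measure.pi fun j => massLaw 1 (r (c j))) =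
        ∫⁻ w, f w ∂Measure.pi fun t => massLaw (Finset.card {j ∈ S | c j = t} : ℕ) (r t) from
    Measure.ext_of_lintegral _ fun f hf => by
      rw [lintegral_map hf (hm Finset.univ), h Finset.univ f hf]
  intro S
  induction S using Finset.induction_on with
  | empty =>
    intro f hf
    have : Measure.pi (fun t => massLaw (Finset.card {j ∈ (∅ : Finset ι) | c j = t} : ℕ) (r t)) =
        Measure.dirac 0 := by
      simp only [Finset.filter_empty, Finset.card_empty, Nat.cast_zero, massLaw_zero]
      refine Measure.pi_eq fun s hs => ?_
      simp only [Measure.dirac_apply' _ (MeasurableSet.univ_pi hs), Measure.dirac_apply' _ (hs _),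
        Set.indicator_apply, Set.mem_pi, Set.mem_univ, true_imp_iff, Pi.zero_apply, Pi.one_apply]
      rw [Finset.prod_ite_zero]
      simp
    rw [this, lintegral_dirac' _ hf]
    simp
    rfl
  | insert i S hi ih =>
    intro f hf
    have e : ∀ (v : ι → ℝ≥0∞) (w : ℝ≥0∞),
        (fun t => ∑ j ∈ insert i S with c j = t, Function.update v i w j) =
        Function.update (fun t => ∑ j ∈ S with c j = t, v j) (c i)
          ((fun t => ∑ j ∈ S with c j = t, v j) (c i) + w) := by
      intro v w
      funext t
      have h2 : ∑ j ∈ S with c j = t, Function.update v i w j = ∑ j ∈ S with c j = t, v j :=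
        Finset.sum_congr rfl fun j hj => Function.update_of_ne (fun h => hi (by
          rw [← h]; exact (Finset.mem_filter.1 hj).1)) _ _
      rw [Finset.filter_insert]
      rcases eq_or_ne t (c i) with rfl | ht
      · rw [if_pos rfl, Finset.sum_insert (by simp [hi]), h2]
        simp [add_comm]
      · rw [if_neg ht.symm, h2, Function.update_of_ne ht]
    have hu : Measurable fun w : T → ℝ≥0∞ =>
        ∫⁻ v, f (Function.update w (c i) (w (c i) + v)) ∂massLaw 1 (r (c i)) :=
      Measurable.lintegral_prod_right' (hf.comp (measurable_update_add (c i)))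
    -- The new exponential is redrawn independently of the partial sums and only enters the group `c
    -- i`, whose shape grows by one.
    rw [lintegral_pi_update _ _ i (fun j _ => rfl) (by exact hf.comp (hm _))]
    simp_rw [e]
    rw [ih _ hu]
    refine lintegral_pi_massLaw_add_one (fun _ => Nat.cast_nonneg _) hr (c i) (fun t => ?_) hf
    rw [Finset.filter_insert]
    rcases eq_or_ne t (c i) with rfl | ht
    · rw [if_pos rfl, if_pos rfl, Finset.card_insert_of_notMem (by simp [hi])]
      push_cast; rfl
    · rw [if_neg ht.symm, if_neg ht, add_zero]

end Grouping

/-! ### Gamma processes with a larger rate -/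

section Scale

variable {X : Type u} [MeasurableSpace X]

/-- The law of a rescaled random measure. -/
def scaleLaw (c : ℝ) (𝒢 : Measure (Measure X)) : Measure (Measure X) :=
  𝒢.map fun g => ENNReal.ofReal c • g

lemma measurable_scale (c : ℝ) : Measurable fun g : Measure X => ENNReal.ofReal c • g :=
  measurable_smul_measure.comp (measurable_const.prodMk measurable_id)

/-- This supplies the process with rate `τ + s` from the prior itself. Complete randomness and the
marginals are inherited by scaling. -/
lemma IsGammaProcess.scaleLaw {α τ s : ℝ} {H : Measure X} [IsFiniteMeasure H]
    {𝒢 : Measure (Measure X)} (h : IsGammaProcess α τ H 𝒢) (hα : 0 < α) (hτ : 0 < τ)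
    (hs : 0 ≤ s) : IsGammaProcess α (τ + s) H (scaleLaw (τ / (τ + s)) 𝒢) := by
  have := h.isProbabilityMeasure
  have hτs : 0 < τ + s := add_pos_of_pos_of_nonneg hτ hs
  have hc : 0 < τ / (τ + s) := div_pos hτ hτs
  have hsc := measurable_scale (X := X) (τ / (τ + s))
  have : IsFiniteMeasure (ENNReal.ofReal α • H) := Measure.smul_finite _ ENNReal.ofReal_ne_top
  have hprob : IsProbabilityMeasure (RankingModel.scaleLaw (τ / (τ + s)) 𝒢) :=
    Measure.isProbabilityMeasure_map hsc.aemeasurable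
  refine ⟨hprob, ?_, fun n A hA hd => ?_, fun A hA => ?_⟩
  -- The scaled law is, up to a nonzero constant, an exponential tilt of `𝒢`. It is therefore
  -- absolutely continuous, and the almost sure atomic form carries over.
  · have hd := (h.isGammaMeasureLaw hα).withDensity_exp hτ hs
    have hac : RankingModel.scaleLaw (τ / (τ + s)) 𝒢 ≪ 𝒢 := by
      have h2 := withDensity_absolutelyContinuous 𝒢 fun g =>
        ENNReal.ofReal (Real.exp (-(s * (g Set.univ).toReal)))
      rw [← hd] at h2
      refine Measure.AbsolutelyContinuous.trans (Measure.absolutelyContinuous_smul ?_) h2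
      simpa using Real.rpow_pos_of_pos hc _
    exact hac.ae_le h.atomic
  · have hm : ∀ i, Measurable fun g : Measure X => g (A i) := fun i =>
      Measure.measurable_coe (hA i)
    have h1 := (h.completelyRandom n A hA hd).comp (fun _ w => ENNReal.ofReal (τ / (τ + s)) * w)
      (fun _ => by fun_prop)
    rw [iIndepFun_iff_map_fun_eq_pi_map fun i => (hm i).aemeasurable]
    rw [iIndepFun_iff_map_fun_eq_pi_map fun i =>
      (show Measurable _ from ((measurable_const_mul _).comp (hm i))).aemeasurable] at h1
    simp only [RankingModel.scaleLaw]
    rw [Measure.map_map (measurable_pi_lambda _ hm) hsc]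
    refine h1.trans ?_
    congr 1
    funext i
    rw [Measure.map_map (hm i) hsc]
    rfl
  · simp only [RankingModel.scaleLaw]
    rw [Measure.map_map (Measure.measurable_coe hA) hsc]
    have h1 := map_mul_massLaw (a := α * H.real A) (by positivity) hτ hc
    rw [massLaw, ← h.marginal A hA, Measure.map_map (by fun_prop) (Measure.measurable_coe hA),
      div_div_cancel₀ hτ.ne'] at h1
    exact h1

end Scale

/-! ### The posterior law as a kernel -/

section PosteriorKernel

variable {X : Type u} {L : ℕ} {m : Fin L → ℕ}

/-- The total waiting time `∑ δ_{ℓik} z_{ℓi}` before the item `x` is seen. -/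
def exposure (y : ∀ ℓ, Fin (m ℓ) → X) (z : ∀ ℓ, Fin (m ℓ) → ℝ) (x : X) : ℝ :=
  ∑ ℓ, ∑ i, notYet y ℓ i x * z ℓ i

lemma exposure_nonneg (y : ∀ ℓ, Fin (m ℓ) → X) {z : ∀ ℓ, Fin (m ℓ) → ℝ} (hz : ∀ ℓ i, 0 ≤ z ℓ i)
    (x : X) : 0 ≤ exposure y z x := by
  refine Finset.sum_nonneg fun ℓ _ => Finset.sum_nonneg fun i _ => mul_nonneg ?_ (hz ℓ i)
  unfold notYet
  split_ifs <;> simp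

/-- The list of all items in the rankings, with repetitions. -/
def allItems (y : ∀ ℓ, Fin (m ℓ) → X) (j : (ℓ : Fin L) × Fin (m ℓ)) : X := y j.1 j.2

variable [MeasurableSpace X]

/-- The rescaling which turns the prior masses into the posterior masses. -/
def rescaleMasses (τ : ℝ) (y : ∀ ℓ, Fin (m ℓ) → X) (z : ∀ ℓ, Fin (m ℓ) → ℝ)
    (p : Measure X × ((ℓ : Fin L) × Fin (m ℓ) → ℝ≥0∞)) :
    Measure X × ((ℓ : Fin L) × Fin (m ℓ) → ℝ≥0∞) :=
  (ENNReal.ofReal (τ / (τ + ∑ ℓ, ∑ i, z ℓ i)) • p.1,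
    fun j => ENNReal.ofReal (τ / (τ + exposure y z (allItems y j))) * p.2 j)

/-- The law of independent masses: a random measure and independent exponential variables. -/
def priorMassLaw (τ : ℝ) (m : Fin L → ℕ) (𝒢 : Measure (Measure X)) :
    Measure (Measure X × ((ℓ : Fin L) × Fin (m ℓ) → ℝ≥0∞)) :=
  𝒢.prod (Measure.pi fun _ => massLaw 1 τ)

lemma isProbabilityMeasure_priorMassLaw {τ : ℝ} (hτ : 0 < τ) (m : Fin L → ℕ)
    (𝒢 : Measure (Measure X)) [IsProbabilityMeasure 𝒢] :
    IsProbabilityMeasure (priorMassLaw τ m 𝒢) := by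
  have := isProbabilityMeasure_massLaw zero_le_one hτ
  unfold priorMassLaw
  infer_instance

lemma measurable_rescaleMasses_right (τ : ℝ) (y : ∀ ℓ, Fin (m ℓ) → X)
    (z : ∀ ℓ, Fin (m ℓ) → ℝ) :
    Measurable (rescaleMasses τ y z : Measure X × _ → Measure X × _) := by
  unfold rescaleMasses
  exact ((measurable_scale _).comp measurable_fst).prodMk (by fun_prop)

section Measurability

variable [MeasurableEq X]

lemma measurable_exposure (j : (ℓ : Fin L) × Fin (m ℓ)) :
    Measurable fun d : (∀ ℓ, Fin (m ℓ) → X) × (∀ ℓ, Fin (m ℓ) → ℝ) =>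
      exposure d.1 d.2 (allItems d.1 j) := by
  classical
  unfold exposure notYet allItems
  refine Finset.measurable_fun_sum _ fun ℓ _ => Finset.measurable_fun_sum _ fun i _ => ?_
  refine Measurable.mul (Measurable.ite ?_ measurable_const measurable_const) (by fun_prop)
  have : {d : (∀ ℓ, Fin (m ℓ) → X) × (∀ ℓ, Fin (m ℓ) → ℝ) | ∃ k < i, d.1 ℓ k = d.1 j.1 j.2} =
      ⋃ k, ⋃ _ : k < i, {d | d.1 ℓ k = d.1 j.1 j.2} := by ext; simp
  rw [this]
  exact MeasurableSet.iUnion fun k => MeasurableSet.iUnion fun _ =>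
    measurableSet_eq_fun (by fun_prop) (by fun_prop)

lemma measurable_rescaleMasses (τ : ℝ) :
    Measurable fun q : ((∀ ℓ, Fin (m ℓ) → X) × (∀ ℓ, Fin (m ℓ) → ℝ)) ×
      (Measure X × ((ℓ : Fin L) × Fin (m ℓ) → ℝ≥0∞)) => rescaleMasses τ q.1.1 q.1.2 q.2 := by
  unfold rescaleMasses
  refine Measurable.prodMk (measurable_smul_measure.comp
    (Measurable.prodMk ?_ measurable_snd.fst)) (measurable_pi_lambda _ fun j => ?_)
  · have : Measurable fun q : ((∀ ℓ, Fin (m ℓ) → X) × (∀ ℓ, Fin (m ℓ) → ℝ)) ×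
        (Measure X × ((ℓ : Fin L) × Fin (m ℓ) → ℝ≥0∞)) => τ / (τ + ∑ ℓ, ∑ i, q.1.2 ℓ i) := by
      fun_prop
    exact this.ennreal_ofReal
  · have : Measurable fun q : ((∀ ℓ, Fin (m ℓ) → X) × (∀ ℓ, Fin (m ℓ) → ℝ)) ×
        (Measure X × ((ℓ : Fin L) × Fin (m ℓ) → ℝ≥0∞)) =>
          exposure q.1.1 q.1.2 (allItems q.1.1 j) := (measurable_exposure j).comp measurable_fst
    exact ((this.const_add τ).const_div τ).ennreal_ofReal.mul
      ((measurable_pi_apply j).comp measurable_snd.snd)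

/-- The masses come from one fixed law and only the factors and locations depend on `(y, z)`. This
joint measurability makes the posterior a kernel. -/
lemma measurable_addAtoms_rescaleMasses (τ : ℝ) :
    Measurable fun q : ((∀ ℓ, Fin (m ℓ) → X) × (∀ ℓ, Fin (m ℓ) → ℝ)) ×
      (Measure X × ((ℓ : Fin L) × Fin (m ℓ) → ℝ≥0∞)) =>
        addAtoms (allItems q.1.1) (rescaleMasses τ q.1.1 q.1.2 q.2) := by
  refine measurable_addAtoms.comp (Measurable.prodMk ?_ (measurable_rescaleMasses τ))
  exact measurable_pi_lambda _ fun j => (measurable_pi_apply j.2).comp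
    ((measurable_pi_apply j.1).comp measurable_fst.fst)

/-- The posterior law as a kernel in the observations. -/
def posteriorKernel (τ : ℝ) (𝒢 : Measure (Measure X)) :
    Kernel ((∀ ℓ, Fin (m ℓ) → X) × (∀ ℓ, Fin (m ℓ) → ℝ)) (Measure X) :=
  (Kernel.id ×ₖ Kernel.const _ (priorMassLaw τ m 𝒢)).map fun q =>
    addAtoms (allItems q.1.1) (rescaleMasses τ q.1.1 q.1.2 q.2)

lemma isMarkovKernel_posteriorKernel {τ : ℝ} (hτ : 0 < τ) (𝒢 : Measure (Measure X))
    [IsProbabilityMeasure 𝒢] : IsMarkovKernel (posteriorKernel (m := m) τ 𝒢) := by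
  have := isProbabilityMeasure_priorMassLaw hτ m 𝒢
  exact Kernel.IsMarkovKernel.map _ (measurable_addAtoms_rescaleMasses τ)

lemma lintegral_posteriorKernel {τ : ℝ} (hτ : 0 < τ) (𝒢 : Measure (Measure X))
    [IsProbabilityMeasure 𝒢] (y : ∀ ℓ, Fin (m ℓ) → X) (z : ∀ ℓ, Fin (m ℓ) → ℝ)
    {f : Measure X → ℝ≥0∞} (hf : Measurable f) :
    ∫⁻ g, f g ∂posteriorKernel τ 𝒢 (y, z) =
      ∫⁻ p, f (addAtoms (allItems y) (rescaleMasses τ y z p)) ∂priorMassLaw τ m 𝒢 := by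
  have := isProbabilityMeasure_priorMassLaw hτ m 𝒢
  have hm := measurable_addAtoms_rescaleMasses (X := X) (m := m) τ
  rw [posteriorKernel, Kernel.lintegral_map _ hm _ hf,
    Kernel.lintegral_id_prod (by exact hf.comp hm)]
  rfl

end Measurability

/-- Multiplying by `τ / (τ + s)` turns rate `τ` into `τ + s`. Nonnegativity of the times keeps all
new rates positive. -/
lemma map_rescaleMasses {τ : ℝ} (hτ : 0 < τ) (𝒢 : Measure (Measure X)) [IsProbabilityMeasure 𝒢]
    (y : ∀ ℓ, Fin (m ℓ) → X) {z : ∀ ℓ, Fin (m ℓ) → ℝ} (hz : ∀ ℓ i, 0 ≤ z ℓ i) :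
    (priorMassLaw τ m 𝒢).map (rescaleMasses τ y z) =
      (scaleLaw (τ / (τ + ∑ ℓ, ∑ i, z ℓ i)) 𝒢).prod
        (Measure.pi fun j => massLaw 1 (τ + exposure y z (allItems y j))) := by
  have := isProbabilityMeasure_massLaw zero_le_one hτ
  have hpos : ∀ j, 0 < τ + exposure y z (allItems y j) := fun j =>
    add_pos_of_pos_of_nonneg hτ (exposure_nonneg y hz _)
  have h := map_mul_pi_massLaw (ι := (ℓ : Fin L) × Fin (m ℓ)) (a := fun _ => 1) (r := fun _ => τ)
    (c := fun j => τ / (τ + exposure y z (allItems y j))) (fun _ => zero_le_one) (fun _ => hτ)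
    (fun j => div_pos hτ (hpos j))
  simp_rw [div_div_cancel₀ hτ.ne'] at h
  rw [← h, scaleLaw, Measure.map_prod_map _ _ (measurable_scale _) (by fun_prop)]
  rfl

lemma sum_smul_dirac_fiber {ι : Type*} [Fintype ι] {T : Finset X} (c : ι → T) [DecidableEq T]
    (v : ι → ℝ≥0∞) :
    ∑ j, v j • Measure.dirac (c j : X) =
      ∑ x : T, (∑ j with c j = x, v j) • Measure.dirac (x : X) := by
  rw [← Finset.sum_fiberwise Finset.univ c]
  refine Finset.sum_congr rfl fun x _ => ?_
  rw [Finset.sum_smul]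
  exact Finset.sum_congr rfl fun j hj => by rw [(Finset.mem_filter.1 hj).2]

/-- The kernel places one exponential atom per occurrence. The exposure depends on the item only, so
occurrences of one item share their rate, and `map_sum_fiber_pi_massLaw` merges them into a gamma
mass whose shape is their number. -/
lemma posteriorKernel_eq_posteriorLaw [MeasurableEq X] {τ : ℝ} (hτ : 0 < τ)
    (𝒢 : Measure (Measure X)) [IsProbabilityMeasure 𝒢] (y : ∀ ℓ, Fin (m ℓ) → X)
    {z : ∀ ℓ, Fin (m ℓ) → ℝ} (hz : ∀ ℓ i, 0 ≤ z ℓ i) :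
    posteriorKernel τ 𝒢 (y, z) =
      posteriorLaw τ (scaleLaw (τ / (τ + ∑ ℓ, ∑ i, z ℓ i)) 𝒢) y z := by
  classical
  have hpos : ∀ x, 0 < τ + exposure y z x := fun x =>
    add_pos_of_pos_of_nonneg hτ (exposure_nonneg y hz _)
  have hprob : IsProbabilityMeasure (scaleLaw (τ / (τ + ∑ ℓ, ∑ i, z ℓ i)) 𝒢) :=
    Measure.isProbabilityMeasure_map (measurable_scale _).aemeasurable
  have hv := fun j => isProbabilityMeasure_massLaw zero_le_one (hpos (allItems y j))
  have hw := fun x : uniqueItems y => isProbabilityMeasure_gammaLaw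
    (Nat.cast_nonneg (occurrences y x)) (hpos x)
  have hw' : ∀ x : uniqueItems y, IsProbabilityMeasure (gammaLaw (occurrences y x)
      (τ + ∑ ℓ, ∑ i, notYet y ℓ i x * z ℓ i)) := hw
  have hmem : ∀ j, allItems y j ∈ uniqueItems y := fun j => by
    simp only [uniqueItems, Finset.mem_biUnion, Finset.mem_univ, true_and, Finset.mem_image]
    exact ⟨j.1, j.2, rfl⟩
  let c : (ℓ : Fin L) × Fin (m ℓ) → uniqueItems y := fun j => ⟨allItems y j, hmem j⟩
  have hcard : ∀ x : uniqueItems y, Finset.card {j | c j = x} = occurrences y x := by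
    intro x
    rw [Finset.card_filter, Fintype.sum_sigma, occurrences]
    refine Finset.sum_congr rfl fun ℓ _ => Finset.sum_congr rfl fun i _ => ?_
    simp only [c, Subtype.ext_iff, allItems]
  have hgroup := map_sum_fiber_pi_massLaw c (r := fun x => τ + exposure y z x) fun x => hpos x
  simp_rw [hcard] at hgroup
  have hgroup2 : (Measure.pi fun x : uniqueItems y =>
      massLaw (occurrences y x) (τ + exposure y z x)) =
      (Measure.pi fun x : uniqueItems y => gammaLaw (occurrences y x) (τ + exposure y z x)).map
        fun w x => ENNReal.ofReal (w x) := by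
    rw [Measure.pi_map_pi (f := fun _ w => ENNReal.ofReal w) (fun x => by fun_prop)]
    rfl
  have hsum : Measurable fun p : Measure X × (uniqueItems y → ℝ≥0∞) =>
      p.1 + ∑ x : uniqueItems y, p.2 x • Measure.dirac (x : X) :=
    measurable_addAtoms_right fun x : uniqueItems y => (x : X)
  have hofReal : Measurable fun (w : uniqueItems y → ℝ) (x : uniqueItems y) =>
      ENNReal.ofReal (w x) := by fun_prop
  refine Measure.ext_of_lintegral _ fun f hf => ?_
  have hresc : Measurable (rescaleMasses τ y z) :=
    measurable_rescaleMasses_right τ y z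
  have hadd : Measurable fun p => f (addAtoms (allItems y) p) :=
    hf.comp (measurable_addAtoms_right _)
  have hf2 : Measurable fun p : Measure X × (uniqueItems y → ℝ≥0∞) =>
      f (p.1 + ∑ x : uniqueItems y, p.2 x • Measure.dirac (x : X)) := hf.comp hsum
  have hf3 : Measurable fun p : Measure X × (uniqueItems y → ℝ) =>
      f (p.1 + ∑ x : uniqueItems y, ENNReal.ofReal (p.2 x) • Measure.dirac (x : X)) :=
    hf2.comp (measurable_fst.prodMk (hofReal.comp measurable_snd))
  rw [lintegral_posteriorKernel hτ 𝒢 y z hf, ← lintegral_map hadd hresc,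
    map_rescaleMasses hτ 𝒢 y hz, lintegral_prod _ hadd.aemeasurable, posteriorLaw,
    lintegral_map hf (by
      exact hsum.comp (measurable_fst.prodMk (hofReal.comp measurable_snd))),
    lintegral_prod _ hf3.aemeasurable]
  refine lintegral_congr fun g => ?_
  have h1 : ∀ v, addAtoms (allItems y) (g, v) =
      g + ∑ x : uniqueItems y, (∑ j with c j = x, v j) • Measure.dirac (x : X) := by
    intro v
    rw [← sum_smul_dirac_fiber c v]
    rfl
  simp_rw [h1]
  have hfg : Measurable fun w : uniqueItems y → ℝ≥0∞ =>
      f (g + ∑ x : uniqueItems y, w x • Measure.dirac (x : X)) := hf2.comp measurable_prodMk_left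
  have h2 := congrArg (fun ν => ∫⁻ w, f (g + ∑ x : uniqueItems y, w x • Measure.dirac (x : X)) ∂ν)
    (hgroup.trans hgroup2)
  rw [lintegral_map hfg (by fun_prop), lintegral_map hfg hofReal] at h2
  exact h2

end PosteriorKernel

/-! ### Tilting by the likelihood -/

section JointLaw

variable {X : Type u} [MeasurableSpace X] [MeasurableEq X] {L : ℕ} {m : Fin L → ℕ}

/-- The normalizing constant of the posterior law. -/
def posteriorConstant (α τ : ℝ) (y : ∀ ℓ, Fin (m ℓ) → X) (z : ∀ ℓ, Fin (m ℓ) → ℝ) : ℝ≥0∞ :=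
  ENNReal.ofReal ((τ / (τ + ∑ ℓ, ∑ i, z ℓ i)) ^ α) *
    ∏ j, ENNReal.ofReal (τ / (τ + exposure y z (allItems y j)))

lemma measurable_posteriorConstant (α τ : ℝ) :
    Measurable fun d : (∀ ℓ, Fin (m ℓ) → X) × (∀ ℓ, Fin (m ℓ) → ℝ) =>
      posteriorConstant α τ d.1 d.2 := by
  unfold posteriorConstant
  refine Measurable.mul (by fun_prop) (Finset.measurable_fun_prod _ fun j _ => ?_)
  exact (((measurable_exposure (X := X) j).const_add τ).const_div τ).ennreal_ofReal

/-- Since `p.1` does not charge the items, removing them affects only the added atoms: the remaining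
mass is `p.1(X)` plus the masses of the atoms not yet seen. Exchanging the sums collects the
exposure of each atom. -/
lemma sum_remainingMass_addAtoms {y : ∀ ℓ, Fin (m ℓ) → X} (z : ∀ ℓ, Fin (m ℓ) → ℝ)
    {p : Measure X × ((ℓ : Fin L) × Fin (m ℓ) → ℝ≥0∞)} (h1 : p.1 Set.univ < ∞)
    (h2 : ∀ j, p.2 j ≠ ∞) (h3 : ∀ j, p.1 {allItems y j} = 0) :
    ∑ ℓ, ∑ i, remainingMass i (addAtoms (allItems y) p, y ℓ) * z ℓ i =
      (∑ ℓ, ∑ i, z ℓ i) * (p.1 Set.univ).toReal +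
        ∑ j, exposure y z (allItems y j) * (p.2 j).toReal := by
  have hfin : addAtoms (allItems y) p Set.univ < ∞ := by
    rw [addAtoms_apply]
    simp [h1, ENNReal.sum_lt_top, (h2 _).lt_top]
  have hmass : ∀ ℓ (i : Fin (m ℓ)), remainingMass i (addAtoms (allItems y) p, y ℓ) =
      (p.1 Set.univ).toReal + ∑ j, notYet y ℓ i (allItems y j) * (p.2 j).toReal := by
    intro ℓ i
    have hS : {x | ∀ k < i, y ℓ k ≠ x} = (y ℓ '' {k | k < i})ᶜ := by ext x; simp
    have hSm : MeasurableSet {x | ∀ k < i, y ℓ k ≠ x} := by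
      rw [hS]; exact (Set.toFinite _).measurableSet.compl
    have h0 : p.1 (y ℓ '' {k | k < i}) = 0 := by
      rw [← Set.biUnion_of_singleton (y ℓ '' {k | k < i}), Set.biUnion_image]
      exact (measure_biUnion_null_iff (Set.toFinite _).countable).2 fun k _ => h3 ⟨ℓ, k⟩
    have hpS : p.1 {x | ∀ k < i, y ℓ k ≠ x} = p.1 Set.univ := by
      rw [hS, measure_compl (Set.toFinite _).measurableSet (by simp [h0]), h0, tsub_zero]
    rw [remainingMass_eq hfin, addAtoms_apply, hpS, ENNReal.toReal_add h1.ne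
      (ENNReal.sum_ne_top.2 fun j _ => ENNReal.mul_ne_top (h2 j) (measure_ne_top _ _)),
      ENNReal.toReal_sum fun j _ => ENNReal.mul_ne_top (h2 j) (measure_ne_top _ _)]
    congr 1
    refine Finset.sum_congr rfl fun j _ => ?_
    rw [ENNReal.toReal_mul, mul_comm, Measure.dirac_apply' _ hSm, notYet]
    congr 1
    by_cases hj : ∃ k < i, y ℓ k = allItems y j
    · rw [if_pos hj, Set.indicator_of_notMem, ENNReal.toReal_zero]
      simpa using hj
    · rw [if_neg hj, Set.indicator_of_mem]
      · simp
      · simpa using hj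
  simp_rw [hmass, exposure, add_mul, Finset.sum_add_distrib, Finset.sum_mul]
  congr 1
  · exact Finset.sum_congr rfl fun ℓ _ => Finset.sum_congr rfl fun i _ => mul_comm _ _
  · rw [Finset.sum_comm (s := Finset.univ (α := (ℓ : Fin L) × Fin (m ℓ)))]
    refine Finset.sum_congr rfl fun ℓ _ => ?_
    rw [Finset.sum_comm]
    exact Finset.sum_congr rfl fun i _ => Finset.sum_congr rfl fun j _ => by ring

variable {α τ : ℝ} {H : Measure X} [IsProbabilityMeasure H] [NullSingletonClass H]
  {𝒢 : Measure (Measure X)}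

/-- Tilting the prior masses by the joint density yields the posterior law. -/
lemma lintegral_jointDensity_addAtoms (h : IsGammaProcess α τ H 𝒢) (hα : 0 < α) (hτ : 0 < τ)
    (y : ∀ ℓ, Fin (m ℓ) → X) {z : ∀ ℓ, Fin (m ℓ) → ℝ} (hz : ∀ ℓ i, 0 ≤ z ℓ i)
    {f : Measure X → ℝ≥0∞} (hf : Measurable f) :
    ∫⁻ p, jointDensity (addAtoms (allItems y) p) y z * f (addAtoms (allItems y) p)
        ∂priorMassLaw τ m 𝒢 =
      posteriorConstant α τ y z * ∫⁻ g, f g ∂posteriorKernel τ 𝒢 (y, z) := by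
  have := h.isProbabilityMeasure
  have hρ := isProbabilityMeasure_massLaw zero_le_one hτ
  have hg := h.isGammaMeasureLaw hα
  have : IsFiniteMeasure (ENNReal.ofReal α • H) := Measure.smul_finite _ ENNReal.ofReal_ne_top
  set s := ∑ ℓ, ∑ i, z ℓ i with hs_def
  have hs : 0 ≤ s := Finset.sum_nonneg fun ℓ _ => Finset.sum_nonneg fun i _ => hz ℓ i
  set e : (ℓ : Fin L) × Fin (m ℓ) → ℝ := fun j => exposure y z (allItems y j) with he_def
  have he : ∀ j, 0 ≤ e j := fun j => exposure_nonneg y hz _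
  -- Almost surely the masses are finite and, since `H` has no atoms, `p.1` does not charge the
  -- items. The likelihood then factors over the independent masses.
  have hae : ∀ᵐ p ∂priorMassLaw τ m 𝒢, jointDensity (addAtoms (allItems y) p) y z =
      ENNReal.ofReal (Real.exp (-(s * (p.1 Set.univ).toReal))) *
        ∏ j, ENNReal.ofReal (Real.exp (-(e j * (p.2 j).toReal))) := by
    have a1 : ∀ᵐ p ∂priorMassLaw τ m 𝒢, p.1 Set.univ < ∞ :=
      Measure.quasiMeasurePreserving_fst.ae (hg.ae_finite hτ)
    have a2 : ∀ᵐ p ∂priorMassLaw τ m 𝒢, ∀ j, p.2 j ≠ ∞ := by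
      refine ae_all_iff.2 fun j => ?_
      refine Measure.quasiMeasurePreserving_snd.ae (p := fun v : _ → ℝ≥0∞ => v j ≠ ∞) ?_
      exact (Measure.quasiMeasurePreserving_eval (fun _ => massLaw 1 τ) j).ae (ae_ne_top_massLaw 1 τ)
    have a3 : ∀ᵐ p ∂priorMassLaw τ m 𝒢, ∀ j, p.1 {allItems y j} = 0 := by
      refine ae_all_iff.2 fun j => ?_
      refine Measure.quasiMeasurePreserving_fst.ae (p := fun g : Measure X => g {allItems y j} = 0) ?_
      exact hg.ae_apply_eq_zero hτ (measurableSet_singleton _) (by simp)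
    filter_upwards [a1, a2, a3] with p h1 h2 h3
    rw [jointDensity, Set.indicator_of_mem (by exact hz), sum_remainingMass_addAtoms z h1 h2 h3,
      neg_add, Real.exp_add, ENNReal.ofReal_mul (Real.exp_pos _).le, ← Finset.sum_neg_distrib,
      Real.exp_sum, ENNReal.ofReal_prod_of_nonneg fun _ _ => (Real.exp_pos _).le]
  have hu : Measurable fun g : Measure X => ENNReal.ofReal
      (Real.exp (-(s * (g Set.univ).toReal))) := by
    have : Measurable fun g : Measure X => (g Set.univ).toReal :=
      (Measure.measurable_coe MeasurableSet.univ).ennreal_toReal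
    fun_prop
  have hv : Measurable fun v : (ℓ : Fin L) × Fin (m ℓ) → ℝ≥0∞ =>
      ∏ j, ENNReal.ofReal (Real.exp (-(e j * (v j).toReal))) := by fun_prop
  have hfa : Measurable fun p => f (addAtoms (allItems y) p) :=
    hf.comp (measurable_addAtoms_right _)
  have hresc : Measurable (rescaleMasses τ y z) :=
    measurable_rescaleMasses_right τ y z
  rw [lintegral_congr_ae (hae.mono fun p hp => by rw [hp]), lintegral_posteriorKernel hτ 𝒢 y z hf,
    ← lintegral_map hfa hresc, map_rescaleMasses hτ 𝒢 y hz, priorMassLaw,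
    lintegral_prod _ (by exact (((hu.comp measurable_fst).mul (hv.comp measurable_snd)).mul
      hfa).aemeasurable)]
  have hpos : ∀ j, 0 < τ + e j := fun j => add_pos_of_pos_of_nonneg hτ (he j)
  have hρ2 := fun j => isProbabilityMeasure_massLaw zero_le_one (hpos j)
  have hprob : IsProbabilityMeasure (scaleLaw (τ / (τ + s)) 𝒢) :=
    Measure.isProbabilityMeasure_map (measurable_scale _).aemeasurable
  have hfg : ∀ g : Measure X, Measurable fun v => f (addAtoms (allItems y) (g, v)) := fun g =>
    hfa.comp measurable_prodMk_left
  have hin : Measurable fun g : Measure X => ∫⁻ v, f (addAtoms (allItems y) (g, v))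
      ∂Measure.pi fun j => massLaw 1 (τ + e j) := hfa.lintegral_prod_right'
  simp_rw [mul_assoc]
  -- The atom masses are tilted first, with `g` fixed; each has shape `1` and contributes the factor
  -- `τ / (τ + e j)`. The tilt of `g` follows and contributes the power `α`, the total mass of the
  -- base measure.
  have step : ∀ g : Measure X, ∫⁻ v, ENNReal.ofReal (Real.exp (-(s * (g Set.univ).toReal))) *
      ((∏ j, ENNReal.ofReal (Real.exp (-(e j * (v j).toReal)))) *
        f (addAtoms (allItems y) (g, v))) ∂(Measure.pi fun _ => massLaw 1 τ) =
      (∏ j, ENNReal.ofReal (τ / (τ + e j))) *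
        (ENNReal.ofReal (Real.exp (-(s * (g Set.univ).toReal))) *
        ∫⁻ v, f (addAtoms (allItems y) (g, v)) ∂Measure.pi fun j => massLaw 1 (τ + e j)) := by
    intro g
    rw [lintegral_const_mul _ (by exact hv.mul (hfg g)),
      lintegral_prod_exp_mul (fun _ => zero_le_one) hτ he (hfg g)]
    simp_rw [Real.rpow_one]
    ring
  simp_rw [step]
  rw [lintegral_const_mul _ (by exact hu.mul hin), lintegral_prod _ hfa.aemeasurable, posteriorConstant]
  have htilt := congrArg (fun ν => ∫⁻ g, ∫⁻ v, f (addAtoms (allItems y) (g, v))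
      ∂(Measure.pi fun j => massLaw 1 (τ + e j)) ∂ν) (hg.withDensity_exp hτ hs)
  have hmass : (ENNReal.ofReal α • H).real Set.univ = α := by
    simp [measureReal_ennreal_smul_apply, hα.le]
  rw [lintegral_smul_measure, lintegral_withDensity_eq_lintegral_mul _ hu hin, hmass] at htilt
  simp only [Pi.mul_apply] at htilt
  rw [← htilt, smul_eq_mul, scaleLaw]
  ring

end JointLaw

end

end RankingModel

namespace RankingModel

noncomputable section

universe u

/-! ### Disintegration with respect to the observations -/

section Evidence

variable {X : Type u} [MeasurableSpace X]

/-- Infinitely many distinct atoms of positive mass cannot all lie in a finite set, and gamma masses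
are finite. -/
lemma IsGammaProcess.ae_hasInfiniteSupport [MeasurableSingletonClass X] {α τ : ℝ} {H : Measure X}
    {𝒢 : Measure (Measure X)} (h : IsGammaProcess α τ H 𝒢) (hα : 0 < α) (hτ : 0 < τ) :
    ∀ᵐ g ∂𝒢, HasInfiniteSupport g := by
  filter_upwards [h.atomic, (h.isGammaMeasureLaw hα).ae_finite hτ] with g hg hfin
  refine ⟨hfin, fun F hF => ?_⟩
  obtain ⟨w, x, hw, hx, rfl⟩ := hg
  obtain ⟨k, hk⟩ : ∃ k, x k ∉ F := by
    by_contra! hall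
    exact Set.infinite_range_of_injective hx (hF.subset (Set.range_subset_iff.2 hall))
  rw [Measure.sum_apply _ hF.measurableSet.compl]
  refine fun h0 => ?_
  have := ENNReal.tsum_eq_zero.1 h0 k
  rw [Measure.smul_apply, Measure.dirac_apply_of_mem hk] at this
  simp [not_le.2 (hw k)] at this

variable [MeasurableEq X] {L : ℕ} {m : Fin L → ℕ}

instance : IsFiniteKernel (rankingsKernel (X := X) m) := by
  unfold rankingsKernel; infer_instance

instance : IsFiniteKernel (arrivalKernel (X := X) m) := by
  unfold arrivalKernel; infer_instance

/-- The set of possible observations: no ranking repeats an item, and times are nonnegative. -/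
def admissible (X : Type*) (m : Fin L → ℕ) :
    Set ((∀ ℓ, Fin (m ℓ) → X) × (∀ ℓ, Fin (m ℓ) → ℝ)) :=
  {d | (∀ ℓ, Function.Injective (d.1 ℓ)) ∧ ∀ ℓ i, 0 ≤ d.2 ℓ i}

lemma measurableSet_admissible : MeasurableSet (admissible X m) := by
  have hinj : MeasurableSet {y : ∀ ℓ, Fin (m ℓ) → X | ∀ ℓ, Function.Injective (y ℓ)} := by
    convert MeasurableSet.univ_pi fun ℓ => measurableSet_injective (X := X) (m ℓ) using 1
    ext y; simp
  exact (hinj.preimage measurable_fst).inter (measurableSet_nonneg.preimage measurable_snd)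

/-- The law of the observations in terms of the moment measure `Q` of the prior. -/
def evidence (α τ : ℝ) (Q : Measure ((ℓ : Fin L) × Fin (m ℓ) → X)) :
    Measure ((∀ ℓ, Fin (m ℓ) → X) × (∀ ℓ, Fin (m ℓ) → ℝ)) :=
  ((Q.map fun y ℓ i => y ⟨ℓ, i⟩).prod (arrivalVolume m)).withDensity
    ((admissible X m).indicator fun d => posteriorConstant α τ d.1 d.2)

instance (α τ : ℝ) (Q : Measure ((ℓ : Fin L) × Fin (m ℓ) → X)) [IsFiniteMeasure Q] :
    SFinite (evidence α τ Q) := by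
  unfold evidence; infer_instance

lemma ae_nonneg_evidence (α τ : ℝ) (Q : Measure ((ℓ : Fin L) × Fin (m ℓ) → X)) :
    ∀ᵐ d ∂evidence α τ Q, ∀ ℓ i, 0 ≤ d.2 ℓ i := by
  rw [evidence, ae_withDensity_iff
    ((measurable_posteriorConstant α τ).indicator measurableSet_admissible)]
  refine ae_of_all _ fun d hd => ?_
  exact (Set.mem_of_indicator_ne_zero hd).2

variable {α τ : ℝ} {H : Measure X} [IsProbabilityMeasure H] [NullSingletonClass H]
  {𝒢 : Measure (Measure X)}

/-- After exchanging the integrals this is `lintegral_jointDensity_addAtoms` at each fixed `z`.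
Times with a negative entry contribute `0` to both sides. -/
lemma lintegral_lintegral_jointDensity_addAtoms (h : IsGammaProcess α τ H 𝒢) (hα : 0 < α)
    (hτ : 0 < τ) {y : ∀ ℓ, Fin (m ℓ) → X} (hy : ∀ ℓ, Function.Injective (y ℓ))
    {f : (∀ ℓ, Fin (m ℓ) → ℝ) → Measure X → ℝ≥0∞} (hf : Measurable (Function.uncurry f)) :
    ∫⁻ p, ∫⁻ z, jointDensity (addAtoms (allItems y) p) y z * f z (addAtoms (allItems y) p)
        ∂arrivalVolume m ∂priorMassLaw τ m 𝒢 =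
      ∫⁻ z, (admissible X m).indicator (fun d => posteriorConstant α τ d.1 d.2) (y, z) *
        ∫⁻ g, f z g ∂posteriorKernel τ 𝒢 (y, z) ∂arrivalVolume m := by
  have := h.isProbabilityMeasure
  have := isProbabilityMeasure_priorMassLaw hτ m 𝒢
  have hadd : Measurable fun p : (Measure X × ((ℓ : Fin L) × Fin (m ℓ) → ℝ≥0∞)) ×
      (∀ ℓ, Fin (m ℓ) → ℝ) => addAtoms (allItems y) p.1 :=
    (measurable_addAtoms_right (allItems y)).comp measurable_fst
  have hJ : Measurable fun p : (Measure X × ((ℓ : Fin L) × Fin (m ℓ) → ℝ≥0∞)) ×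
      (∀ ℓ, Fin (m ℓ) → ℝ) => jointDensity (addAtoms (allItems y) p.1) y p.2 := by
    have hmap : Measurable fun p : (Measure X × ((ℓ : Fin L) × Fin (m ℓ) → ℝ≥0∞)) ×
        (∀ ℓ, Fin (m ℓ) → ℝ) => (addAtoms (allItems y) p.1, y, p.2) :=
      hadd.prodMk (measurable_const.prodMk measurable_snd)
    have := measurable_jointDensity.comp hmap
    exact this
  have hfA : Measurable fun p : (Measure X × ((ℓ : Fin L) × Fin (m ℓ) → ℝ≥0∞)) ×
      (∀ ℓ, Fin (m ℓ) → ℝ) => f p.2 (addAtoms (allItems y) p.1) :=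
    hf.comp (measurable_snd.prodMk hadd)
  rw [lintegral_lintegral_swap (hJ.mul hfA).aemeasurable]
  refine lintegral_congr fun z => ?_
  by_cases hz : ∀ ℓ i, 0 ≤ z ℓ i
  · rw [Set.indicator_of_mem (show (y, z) ∈ admissible X m from ⟨hy, hz⟩)]
    have hfz : Measurable (f z) := hf.comp (measurable_prodMk_left (x := z))
    exact lintegral_jointDensity_addAtoms h hα hτ y hz hfz
  · rw [Set.indicator_of_notMem (show (y, z) ∉ admissible X m from fun hd => hz hd.2), zero_mul]
    have : ∀ g : Measure X, jointDensity g y z = 0 := fun g =>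
      Set.indicator_of_notMem (by exact hz) _
    simp [this]

/-- Disintegration of the joint law of the random measure, the rankings and the inter-arrival
times with respect to the observations. -/
lemma exists_evidence (h : IsGammaProcess α τ H 𝒢) (hα : 0 < α) (hτ : 0 < τ) (m : Fin L → ℕ) :
    ∃ Q : Measure ((ℓ : Fin L) × Fin (m ℓ) → X), IsFiniteMeasure Q ∧
      ∀ f : (∀ ℓ, Fin (m ℓ) → X) × (∀ ℓ, Fin (m ℓ) → ℝ) → Measure X → ℝ≥0∞,
        Measurable (Function.uncurry f) →
        ∫⁻ g, ∫⁻ y, ∫⁻ z, f (y, z) g ∂arrivalKernel m (g, y) ∂rankingsKernel m g ∂𝒢 =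
          ∫⁻ d, ∫⁻ g, f d g ∂posteriorKernel τ 𝒢 d ∂evidence α τ Q := by
  classical
  have := h.isProbabilityMeasure
  have hprior := isProbabilityMeasure_priorMassLaw hτ m 𝒢
  have hker := isMarkovKernel_posteriorKernel (m := m) hτ 𝒢
  have : IsFiniteMeasure (ENNReal.ofReal α • H) := Measure.smul_finite _ ENNReal.ofReal_ne_top
  obtain ⟨Q, hQ, hp⟩ := (h.isGammaMeasureLaw hα).palm_pi hτ ((ℓ : Fin L) × Fin (m ℓ))
  refine ⟨Q, hQ, fun f hf => ?_⟩
  have hcurry : Measurable fun (y : (ℓ : Fin L) × Fin (m ℓ) → X) ℓ (i : Fin (m ℓ)) => y ⟨ℓ, i⟩ := by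
    fun_prop
  have hinj : MeasurableSet {y : ∀ ℓ, Fin (m ℓ) → X | ∀ ℓ, Function.Injective (y ℓ)} := by
    convert MeasurableSet.univ_pi fun ℓ => measurableSet_injective (X := X) (m ℓ) using 1
    ext y; simp
  have hJf : Measurable fun p : ((∀ ℓ, Fin (m ℓ) → X) × Measure X) × (∀ ℓ, Fin (m ℓ) → ℝ) =>
      jointDensity p.1.2 p.1.1 p.2 * f (p.1.1, p.2) p.1.2 :=
    (measurable_jointDensity.comp
      (measurable_fst.snd.prodMk (measurable_fst.fst.prodMk measurable_snd))).mul
      (hf.comp ((measurable_fst.fst.prodMk measurable_snd).prodMk measurable_fst.snd))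
  obtain ⟨F, hF_def⟩ : ∃ F : (∀ ℓ, Fin (m ℓ) → X) → Measure X → ℝ≥0∞,
      ∀ y g, F y g = {y | ∀ ℓ, Function.Injective (y ℓ)}.indicator
        (fun y => ∫⁻ z, jointDensity g y z * f (y, z) g ∂arrivalVolume m) y :=
    ⟨_, fun _ _ => rfl⟩
  have hF : Measurable (Function.uncurry F) := by
    simp only [Set.indicator_apply, Function.uncurry_def, hF_def]
    exact Measurable.ite (hinj.preimage measurable_fst) hJf.lintegral_prod_right' measurable_const
  have hW := (measurable_posteriorConstant (X := X) (m := m) α τ).indicator measurableSet_admissible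
  have hin : Measurable fun d => ∫⁻ g, f d g ∂posteriorKernel τ 𝒢 d :=
    hf.lintegral_kernel_prod_right'
  have e1 : ∫⁻ g, ∫⁻ y, ∫⁻ z, f (y, z) g ∂arrivalKernel m (g, y) ∂rankingsKernel m g ∂𝒢 =
      ∫⁻ g, g Set.univ ^ Fintype.card ((ℓ : Fin L) × Fin (m ℓ)) *
        ∫⁻ y, F (fun ℓ i => y ⟨ℓ, i⟩) g
          ∂Measure.pi (fun _ : (ℓ : Fin L) × Fin (m ℓ) => normalize g) ∂𝒢 := by
    refine lintegral_congr_ae ?_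
    filter_upwards [h.ae_hasInfiniteSupport hα hτ] with g hg
    have hfg : Measurable (Function.uncurry fun y z => f (y, z) g) :=
      hf.comp (measurable_id.prodMk (measurable_const (a := g)))
    simp only [hF_def]
    exact lintegral_rankingsKernel_arrivalKernel hg hfg
  have hF2 : Measurable (Function.uncurry fun (y : (ℓ : Fin L) × Fin (m ℓ) → X) g =>
      F (fun ℓ i => y ⟨ℓ, i⟩) g) := by
    have : Measurable fun p : ((ℓ : Fin L) × Fin (m ℓ) → X) × Measure X =>
        ((fun ℓ (i : Fin (m ℓ)) => p.1 ⟨ℓ, i⟩), p.2) :=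
      (hcurry.comp measurable_fst).prodMk measurable_snd
    exact Measurable.comp (g := Function.uncurry F) hF this
  -- The Palm formula exchanges the roles: the items are now integrated outermost, and the measure
  -- becomes a prior draw with atoms added at them.
  have e2 := hp _ hF2
  have hWin : Measurable fun d => (admissible X m).indicator
      (fun d => posteriorConstant α τ d.1 d.2) d * ∫⁻ g, f d g ∂posteriorKernel τ 𝒢 d :=
    hW.mul hin
  have hWin2 : Measurable fun y => ∫⁻ z, (admissible X m).indicator
      (fun d => posteriorConstant α τ d.1 d.2) (y, z) *
        ∫⁻ g, f (y, z) g ∂posteriorKernel τ 𝒢 (y, z) ∂arrivalVolume m :=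
    hWin.lintegral_prod_right'
  rw [e1, e2, evidence, lintegral_withDensity_eq_lintegral_mul _ hW hin]
  simp only [Pi.mul_apply]
  rw [lintegral_prod _ hWin.aemeasurable, lintegral_map hWin2 hcurry]
  refine lintegral_congr fun y' => ?_
  set y : ∀ ℓ, Fin (m ℓ) → X := fun ℓ i => y' ⟨ℓ, i⟩ with hy_def
  have hy' : y' = allItems y := rfl
  change ∫⁻ p, F y (addAtoms y' p) ∂priorMassLaw τ m 𝒢 = _
  by_cases hy : ∀ ℓ, Function.Injective (y ℓ)
  · simp only [hF_def, hy', Set.indicator_of_mem (show y ∈ {y : ∀ ℓ, Fin (m ℓ) → X |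
      ∀ ℓ, Function.Injective (y ℓ)} from hy)]
    have hfy : Measurable (Function.uncurry fun z g => f (y, z) g) := by
      have hmap : Measurable fun q : (∀ ℓ, Fin (m ℓ) → ℝ) × Measure X => ((y, q.1), q.2) :=
        (measurable_const.prodMk measurable_fst).prodMk measurable_snd
      exact hf.comp hmap
    exact lintegral_lintegral_jointDensity_addAtoms h hα hτ hy hfy
  -- Rankings with a repeated item are excluded on both sides, by the indicator in `F` and by
  -- `admissible`.
  · have h1 : ∀ g, F y g = 0 := fun g =>
      (hF_def y g).trans (Set.indicator_of_notMem (by exact hy) _)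
    have h2 : ∀ z, (admissible X m).indicator
        (fun d => posteriorConstant α τ d.1 d.2) (y, z) = 0 := fun z =>
      Set.indicator_of_notMem (fun hd => hy hd.1) _
    simp [h1, h2]

end Evidence

end

end RankingModel

/-! ### The posterior of the gamma process -/

theorem theorem2 {Ω X : Type*} [MeasurableSpace Ω] (P : Measure Ω) [IsProbabilityMeasure P]
    [MeasurableSpace X] [MeasurableEq X] (α τ : ℝ) (hα : 0 < α) (hτ : 0 < τ)
    (H : Measure X) [IsProbabilityMeasure H] [NullSingletonClass H]
    (L : ℕ) (m : Fin L → ℕ)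
    (G : Ω → Measure X) (Y : Ω → (ℓ : Fin L) → Fin (m ℓ) → X)
    (Z : Ω → (ℓ : Fin L) → Fin (m ℓ) → ℝ)
    (hG : RankingModel.IsGammaProcess α τ H (P.map G))
    (hY : HasCondDistrib Y G (RankingModel.rankingsKernel m) P)
    (hZ : HasCondDistrib Z (fun ω => (G ω, Y ω)) (RankingModel.arrivalKernel m) P) :
    ∃ κ : Kernel (((ℓ : Fin L) → Fin (m ℓ) → X) × ((ℓ : Fin L) → Fin (m ℓ) → ℝ)) (Measure X),
      IsMarkovKernel κ ∧
      HasCondDistrib G (fun ω => (Y ω, Z ω)) κ P ∧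
      ∀ᵐ d ∂(P.map fun ω => (Y ω, Z ω)), ∃ 𝒢 : Measure (Measure X),
        RankingModel.IsGammaProcess α (τ + ∑ ℓ, ∑ i, d.2 ℓ i) H 𝒢 ∧
        κ d = RankingModel.posteriorLaw τ 𝒢 d.1 d.2 := by
  have hGprob := hG.isProbabilityMeasure
  have hκ := RankingModel.isMarkovKernel_posteriorKernel (m := m) hτ (P.map G)
  have hGm : AEMeasurable G P := hY.aemeasurable_fst
  have hYm : AEMeasurable Y P := hY.aemeasurable_snd
  have hZm : AEMeasurable Z P := hZ.aemeasurable_snd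
  obtain ⟨Q, hQ, hQf⟩ := RankingModel.exists_evidence hG hα hτ m
  have hjoint : P.map (fun ω => ((Y ω, Z ω), G ω)) =
      RankingModel.evidence α τ Q ⊗ₘ RankingModel.posteriorKernel τ (P.map G) := by
    refine Measure.ext_of_lintegral _ fun f hf => ?_
    have hrot : Measurable fun p : (Measure X × ((ℓ : Fin L) → Fin (m ℓ) → X)) ×
        ((ℓ : Fin L) → Fin (m ℓ) → ℝ) => ((p.1.2, p.2), p.1.1) := by fun_prop
    have e : P.map (fun ω => ((Y ω, Z ω), G ω)) =
        (P.map fun ω => ((G ω, Y ω), Z ω)).map fun p => ((p.1.2, p.2), p.1.1) := by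
      rw [AEMeasurable.map_map_of_aemeasurable hrot.aemeasurable (by fun_prop)]
      rfl
    have hin : Measurable fun p => ∫⁻ z, f ((p.2, z), p.1) ∂(RankingModel.arrivalKernel m p) :=
      (hf.comp hrot).lintegral_kernel_prod_right'
    rw [Measure.lintegral_compProd hf, e, hZ.map_eq, hY.map_eq, lintegral_map hf hrot,
      Measure.lintegral_compProd (by exact hf.comp hrot), Measure.lintegral_compProd hin]
    exact hQf (fun d g => f (d, g)) hf
  -- The posterior kernel is Markov, so the first marginal of the disintegration identifies
  -- `evidence` as the law of the observations.
  have hmarg : P.map (fun ω => (Y ω, Z ω)) = RankingModel.evidence α τ Q := by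
    have := congrArg Measure.fst hjoint
    rwa [Measure.fst_compProd, Measure.fst_map_prodMk₀ hGm] at this
  refine ⟨RankingModel.posteriorKernel τ (P.map G), hκ, ⟨by fun_prop, ?_⟩, ?_⟩
  · rw [hmarg, hjoint]
  · rw [hmarg]
    filter_upwards [RankingModel.ae_nonneg_evidence α τ Q] with d hd
    -- The law of `G*` is the prior law rescaled by `τ / (τ + ∑ z)`. The times are almost surely
    -- nonnegative, so the new rate is at least `τ`.
    exact ⟨_, hG.scaleLaw hα hτ (Finset.sum_nonneg fun ℓ _ => Finset.sum_nonneg fun i _ => hd ℓ i),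
      RankingModel.posteriorKernel_eq_posteriorLaw hτ (P.map G) d.1 hd⟩
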